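/- For a C*-algebra $\mathcal A$ let $\mathfrak S(\mathcal A)$ denote its set of states (positive linear functionals of norm one). Let $\mathcal F$ be a unital C*-algebra and $\mathfrak S_0\subsetneq\mathfrak S(\mathcal F)$ a proper subset of its states. An *ideal host* for the pair $(\mathcal F,\mathfrak S_0)$ is a C*-algebra $\mathcal L$ for which there are a unital C*-algebra $\mathcal E$ containing $\mathcal L$ as a closed two-sided ideal and a unital $*$-homomorphism $\xi:\mathcal F\to\mathcal E$ such that (i) $\mathcal E$ is generated as a C*-algebra by $\mathcal L\cup\xi(\mathcal F)$, and (ii) the map $\theta:\mathfrak S(\mathcal L)\to\mathfrak S(\mathcal F)$, $\theta(\omega)=\widehat\omega\circ\xi$, where $\widehat\omega$ is the unique extension of $\omega$ to a state of $\mathcal E$, is injective and has range $\mathfrak S_0$. Let $\mathcal N$ be a factor (a von Neumann algebra on a complex Hilbert space with centre $\mathbb C\mathbb 1$) which is simple, i.e. $\mathcal N\neq\{0\}$ and $\mathcal N$ has no norm-closed two-sided ideals other than $\{0\}$ and $\mathcal N$. Let $\mathfrak S_0$ be its set of normal states, and assume that $\mathfrak S_0$ is a proper subset of $\mathfrak S(\mathcal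 N)$ (equivalently, that $\mathcal N$ is infinite-dimensional). Then $\mathfrak S_0$ contains no pure state of $\mathcal N$, and there is no ideal host for the pair $(\mathcal N,\mathfrak S_0)$. -/

import Mathlib

/-! ## States of C⋆-algebras -/

section States

open scoped ComplexOrder

variable {A : Type*} [NonUnitalNormedRing A] [StarRing A] [NormedSpace ℂ A]

/-- The state space of a (possibly non-unital) C⋆-algebra: the continuous linear functionals that
are positive and have norm one. Here `0 ≤ z` for `z : ℂ` means that `z` is real and nonnegative. -/
def stateSpace (A : Type*) [NonUnitalNormedRing A] [StarRing A] [NormedSpace ℂ A] :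
    Set (StrongDual ℂ A) :=
  {ω | (∀ a : A, 0 ≤ ω (star a * a)) ∧ ‖ω‖ = 1}

/-- A pure state: an extreme point of the state space. -/
def IsPureState (ω : StrongDual ℂ A) : Prop :=
  ω ∈ Set.extremePoints ℝ (stateSpace A)

end States

/-! ## Simple C⋆-algebras -/

/-- A unital C⋆-algebra is simple if it is nonzero and its only norm-closed two-sided ideals are
the zero ideal and the whole algebra. -/
def IsSimpleCStarAlgebra (A : Type*) [CStarAlgebra A] : Prop :=
  Nontrivial A ∧ ∀ I : TwoSidedIdeal A, IsClosed (I : Set A) → I = ⊥ ∨ I = ⊤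

/-! ## Hosts -/

section Hosts

variable {F E : Type*} [CStarAlgebra F] [CStarAlgebra E]

/-- `IsExtendedState L ξ ω ψ` says that `ψ = θ(ω)`: the functional `ψ` on `F` is obtained from the
functional `ω` on the subalgebra `L ⊆ E` by extending `ω` to a state `φ` of `E` and pulling `φ` back
along `ξ : F → E`. If `L` is a hereditary C⋆-subalgebra and `ω` is a state of `L`, then there is
exactly one such `φ`, so that there is exactly one such `ψ`. -/
def IsExtendedState (L : NonUnitalStarSubalgebra ℂ E) (ξ : F →⋆ₐ[ℂ] E)
    (ω : StrongDual ℂ L) (ψ : StrongDual ℂ F) : Prop :=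
  ∃ φ ∈ stateSpace E, (∀ x : L, φ (x : E) = ω x) ∧ ∀ f : F, ψ f = φ (ξ f)

/-- `L ⊆ E`, together with the unital ⋆-homomorphism `ξ : F → E`, is a host for the pair
`(F, S₀)`. -/
structure IsHost (S₀ : Set (StrongDual ℂ F)) (L : NonUnitalStarSubalgebra ℂ E)
    (ξ : F →⋆ₐ[ℂ] E) : Prop where
  /-- `L` is a C⋆-subalgebra of `E`. -/
  isClosed : IsClosed (L : Set E)
  /-- `L` is hereditary in `E`, that is, `L E L ⊆ L`. -/
  hereditary : ∀ a ∈ L, ∀ b ∈ L, ∀ x : E, a * x * b ∈ L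
  /-- `E` is generated, as a C⋆-algebra, by `L` and `ξ(F)`. -/
  generates : (StarAlgebra.adjoin ℂ ((L : Set E) ∪ Set.range ξ)).topologicalClosure = ⊤
  /-- The extension map `θ` is injective on the state space of `L`. -/
  injective : ∀ ω₁ ∈ stateSpace L, ∀ ω₂ ∈ stateSpace L, ∀ ψ : StrongDual ℂ F,
    IsExtendedState L ξ ω₁ ψ → IsExtendedState L ξ ω₂ ψ → ω₁ = ω₂
  /-- The image under `θ` of the state space of `L` is `S₀`. -/
  range_eq : {ψ : StrongDual ℂ F | ∃ ω ∈ stateSpace L, IsExtendedState L ξ ω ψ} = S₀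

/-- An ideal host is a host that is a two-sided ideal of `E`. -/
structure IsIdealHost (S₀ : Set (StrongDual ℂ F)) (L : NonUnitalStarSubalgebra ℂ E)
    (ξ : F →⋆ₐ[ℂ] E) : Prop extends IsHost S₀ L ξ where
  /-- `L` is a two-sided ideal of `E`. -/
  ideal : ∀ a ∈ L, ∀ x : E, x * a ∈ L ∧ a * x ∈ L

end Hosts

/-! ## Von Neumann algebras -/

namespace VonNeumannAlgebra

variable {H : Type*} [NormedAddCommGroup H] [InnerProductSpace ℂ H] [CompleteSpace H]

instance instSMulMemClassComplex : SMulMemClass (VonNeumannAlgebra H) ℂ (H →L[ℂ] H) where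
  smul_mem {N} c _ hx := N.toStarSubalgebra.smul_mem hx c

/-- A von Neumann algebra is norm closed, hence (by Mathlib's instance for closed
⋆-subalgebras) it is a unital C⋆-algebra. -/
instance instIsClosedCoe (N : VonNeumannAlgebra H) : IsClosed (N : Set (H →L[ℂ] H)) := by
  rw [← N.centralizer_centralizer]
  exact Set.isClosed_centralizer _

/-- A factor: the centre `N ∩ N'` consists of the scalar multiples of the identity. -/
def IsFactor (N : VonNeumannAlgebra H) : Prop :=
  ∀ z ∈ N, z ∈ N.commutant → ∃ c : ℂ, z = c • (1 : H →L[ℂ] H)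

/-- A functional `ω` on `N` is normal if it preserves suprema of (nonempty) upward directed sets of
self-adjoint elements of `N`, equivalently of increasing nets; `N` is ordered as a subset of the
bounded operators. (For positive `ω` the values at self-adjoint elements are real.) -/
def IsNormal (N : VonNeumannAlgebra H) (ω : StrongDual ℂ N) : Prop :=
  ∀ D : Set N, D.Nonempty → DirectedOn (· ≤ ·) D → (∀ x ∈ D, IsSelfAdjoint x) →
    ∀ a : N, IsLUB D a → IsLUB ((fun x : N => (ω x).re) '' D) (ω a).re

/-- The set (folium) of normal states of a von Neumann algebra. -/
def normalStates (N : VonNeumannAlgebra H) : Set (StrongDual ℂ N) :=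
  {ω ∈ stateSpace N | N.IsNormal ω}

end VonNeumannAlgebra

/-! The two assertions are linked: an ideal host would force a normal pure state to exist, and a
normal pure state would force `N` to be finite-dimensional.

Hosts. The normal states form a nonempty face of the state space (`isExtreme_normalStates`). If `L`
is an ideal host for such a face, then `L` has a state, hence by Krein–Milman a pure state `ω`. Let
`ψ` be its image under the extension map. A convex decomposition of `ψ` stays in the face, so it
lifts to `L`; injectivity turns it into a decomposition of `ω`, which is trivial. Extensions from an
ideal are unique, so the decomposition of `ψ` is trivial too and `ψ` is pure
(`IsIdealHost.exists_isPureState`).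

Pure states. A normal state dominates a nonzero vector functional (`exists_vectorFunctional_le`), so
a normal pure state `ω` is the vector state of some unit vector `η`. Purity makes the projection `p`
onto the closure of `N'η` minimal: `p x p = ω(x) p` (`exists_minimal_projection`). In a simple
algebra the closed ideal generated by `p` contains `1`, so a finite sum of elements `a p b` is
invertible, and the collapse of `p A p` to scalars makes the algebra finite-dimensional
(`IsSimpleCStarAlgebra.finiteDimensional`). Then every state is normal, against properness. -/

open Filter Topology
open scoped ComplexOrder

/-! ### Positive functionals and approximate units -/

section PositiveFunctionals

variable {A : Type*} [NonUnitalCStarAlgebra A]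

/-- Polarization: positivity at `x + y` and `x + iy` gives the imaginary and the real part of the
identity respectively. -/
theorem map_star_mul_conj_symm {f : StrongDual ℂ A} (hf : ∀ a, 0 ≤ f (star a * a)) (x y : A) :
    (starRingEnd ℂ) (f (star y * x)) = f (star x * y) := by
  have him : ∀ a, (f (star a * a)).im = 0 := fun a => (Complex.nonneg_iff.1 (hf a)).2.symm
  have h1 := him (x + y)
  have h2 := him (x + Complex.I • y)
  simp only [star_add, star_smul, add_mul, mul_add, map_add, smul_mul_assoc, mul_smul_comm,
    map_smul, Complex.add_im, him, Complex.star_def, Complex.conj_I, smul_eq_mul,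
    Complex.mul_im, Complex.mul_re, Complex.I_re, Complex.I_im, Complex.neg_re,
    Complex.neg_im] at h1 h2
  apply Complex.ext
  · simp only [Complex.conj_re]; linarith
  · simp only [Complex.conj_im]; linarith

/-- The positive semidefinite sesquilinear form of a positive functional. -/
@[reducible]
noncomputable def positiveFunctionalCore (f : StrongDual ℂ A) (hf : ∀ a, 0 ≤ f (star a * a)) :
    PreInnerProductSpace.Core ℂ A where
  inner x y := f (star x * y)
  conj_inner_symm x y := map_star_mul_conj_symm hf x y
  re_inner_nonneg x := (Complex.nonneg_iff.1 (hf x)).1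
  add_left x y z := by simp [add_mul]
  smul_left x y r := by simp [smul_mul_assoc]

/-- The Cauchy–Schwarz inequality for positive functionals. -/
theorem norm_map_star_mul_sq_le {f : StrongDual ℂ A} (hf : ∀ a, 0 ≤ f (star a * a)) (x y : A) :
    ‖f (star x * y)‖ ^ 2 ≤ (f (star x * x)).re * (f (star y * y)).re := by
  have h := @InnerProductSpace.Core.inner_mul_inner_self_le ℂ A _ _ _
    (positiveFunctionalCore f hf) x y
  change ‖f (star x * y)‖ * ‖f (star y * x)‖ ≤ (f (star x * x)).re * (f (star y * y)).re at h
  rwa [← map_star_mul_conj_symm hf y x, RCLike.norm_conj, ← sq] at h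

theorem exists_selfAdjoint_approximateUnit (A : Type*) [NonUnitalCStarAlgebra A] :
    ∃ l : Filter A, l.NeBot ∧ (∀ᶠ e in l, IsSelfAdjoint e ∧ ‖e‖ ≤ 1) ∧
      ∀ x : A, Tendsto (fun e => e * x) l (𝓝 x) := by
  let _ := CStarAlgebra.spectralOrder A
  have := CStarAlgebra.spectralOrderedRing A
  have h := CStarAlgebra.increasingApproximateUnit A
  refine ⟨CStarAlgebra.approximateUnit A, h.neBot, ?_, fun x => h.tendsto_mul_right x⟩
  filter_upwards [h.eventually_isSelfAdjoint, h.eventually_norm] with e h1 h2 using ⟨h1, h2⟩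

theorem norm_map_le_of_mem_stateSpace {ω : StrongDual ℂ A} (hω : ω ∈ stateSpace A) (x : A) :
    ‖ω x‖ ≤ ‖x‖ := by
  simpa [hω.2] using ω.le_opNorm x

/-- The values of a state at the squares of an approximate unit tend to `1`. -/
theorem tendsto_state_approximateUnit {ω : StrongDual ℂ A} (hω : ω ∈ stateSpace A) {l : Filter A}
    (hl : ∀ᶠ e in l, IsSelfAdjoint e ∧ ‖e‖ ≤ 1) (hlx : ∀ x : A, Tendsto (fun e => e * x) l (𝓝 x)) :
    Tendsto (fun e => ω (e * e)) l (𝓝 1) := by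
  have hreal : ∀ᶠ e in l, ω (e * e) = ((ω (e * e)).re : ℂ) := by
    filter_upwards [hl] with e he
    have := hω.1 e
    rw [he.1.star_eq] at this
    exact Complex.ext rfl (by simpa using (Complex.nonneg_iff.1 this).2.symm)
  suffices h : Tendsto (fun e => (ω (e * e)).re) l (𝓝 1) by
    refine Tendsto.congr' (hreal.mono fun e he => he.symm) ?_
    simpa [Function.comp_def] using (Complex.continuous_ofReal.tendsto 1).comp h
  have hupper : ∀ᶠ e in l, (ω (e * e)).re ≤ 1 := by
    filter_upwards [hl] with e he
    calc (ω (e * e)).re ≤ ‖ω (e * e)‖ := Complex.re_le_norm _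
      _ ≤ ‖e * e‖ := norm_map_le_of_mem_stateSpace hω _
      _ ≤ ‖e‖ * ‖e‖ := norm_mul_le _ _
      _ ≤ 1 := mul_le_one₀ he.2 (norm_nonneg _) he.2
  refine tendsto_order.2 ⟨fun r hr => ?_, fun r hr => hupper.mono fun e he => he.trans_lt hr⟩
  -- For a nearly norming `x` in the unit ball, `ω(ex) → ω(x)`, while Cauchy–Schwarz gives `|ω(ex)|²
  -- ≤ ω(e²)`. So any `s < 1` with `s² > r` yields the lower bound.
  obtain ⟨s, hs0, hrs, hs1⟩ : ∃ s : ℝ, 0 ≤ s ∧ r < s ^ 2 ∧ s < 1 := by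
    refine ⟨√((max r 0 + 1) / 2), Real.sqrt_nonneg _, ?_, ?_⟩
    · rw [Real.sq_sqrt (by positivity)]
      rcases max_cases r 0 with h | h <;> linarith
    · rw [Real.sqrt_lt' one_pos]
      rcases max_cases r 0 with h | h <;> linarith
  obtain ⟨x, hx1, hx⟩ : ∃ x : A, ‖x‖ ≤ 1 ∧ s < ‖ω x‖ := by
    obtain ⟨x, hx1, hx⟩ := ω.exists_lt_apply_of_lt_opNorm (hω.2 ▸ hs1)
    exact ⟨x, hx1.le, hx⟩
  have hev : ∀ᶠ e in l, s < ‖ω (e * x)‖ :=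
    ((ω.continuous.norm.tendsto x).comp (hlx x)).eventually (lt_mem_nhds hx)
  filter_upwards [hev, hl] with e he hle
  have hcs := norm_map_star_mul_sq_le hω.1 e x
  rw [hle.1.star_eq] at hcs
  have hxx : (ω (star x * x)).re ≤ 1 := by
    calc (ω (star x * x)).re ≤ ‖ω (star x * x)‖ := Complex.re_le_norm _
      _ ≤ ‖star x * x‖ := norm_map_le_of_mem_stateSpace hω _
      _ = ‖x‖ * ‖x‖ := CStarRing.norm_star_mul_self
      _ ≤ 1 := mul_le_one₀ hx1 (norm_nonneg _) hx1
  have hee : 0 ≤ (ω (e * e)).re := by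
    have := (Complex.nonneg_iff.1 (hω.1 e)).1
    rwa [hle.1.star_eq] at this
  nlinarith [pow_lt_pow_left₀ he hs0 two_ne_zero]

theorem one_le_norm_of_tendsto {f : StrongDual ℂ A} {l : Filter A} [l.NeBot]
    (hl : ∀ᶠ e in l, IsSelfAdjoint e ∧ ‖e‖ ≤ 1) (hf : Tendsto (fun e => f (e * e)) l (𝓝 1)) :
    1 ≤ ‖f‖ := by
  have h := hf.norm
  rw [norm_one] at h
  refine le_of_tendsto h (hl.mono fun e he => ?_)
  calc ‖f (e * e)‖ ≤ ‖f‖ * ‖e * e‖ := f.le_opNorm _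
    _ ≤ ‖f‖ * 1 := by
      gcongr
      exact (norm_mul_le _ _).trans (mul_le_one₀ he.2 (norm_nonneg _) he.2)
    _ = ‖f‖ := mul_one _

/-- The state space of a (possibly non-unital) C⋆-algebra is convex. -/
theorem convex_stateSpace (A : Type*) [NonUnitalCStarAlgebra A] : Convex ℝ (stateSpace A) := by
  intro f hf g hg s t hs ht hst
  obtain ⟨l, hl0, hl, hlx⟩ := exists_selfAdjoint_approximateUnit A
  have hst' : (s : ℂ) + t = 1 := by exact_mod_cast hst
  refine ⟨fun a => ?_, le_antisymm ?_ ?_⟩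
  · have hs' : (0 : ℂ) ≤ s := by exact_mod_cast hs
    have ht' : (0 : ℂ) ≤ t := by exact_mod_cast ht
    exact add_nonneg (mul_nonneg hs' (hf.1 a)) (mul_nonneg ht' (hg.1 a))
  · calc ‖s • f + t • g‖ ≤ ‖s • f‖ + ‖t • g‖ := norm_add_le _ _
      _ = s + t := by rw [norm_smul, norm_smul, hf.2, hg.2, Real.norm_of_nonneg hs,
          Real.norm_of_nonneg ht, mul_one, mul_one]
      _ = 1 := hst
  · refine one_le_norm_of_tendsto hl ?_
    have := ((tendsto_state_approximateUnit hf hl hlx).const_mul (s : ℂ)).add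
      ((tendsto_state_approximateUnit hg hl hlx).const_mul (t : ℂ))
    rw [mul_one, mul_one, hst'] at this
    exact this

end PositiveFunctionals

/-! ### States of unital C⋆-algebras -/

section Unital

variable {A : Type*} [CStarAlgebra A]

theorem exists_star_mul_self_eq_norm_sq_sub (x : A) :
    ∃ y : A, star y * y = algebraMap ℝ A (‖x‖ ^ 2) - star x * x := by
  let _ := CStarAlgebra.spectralOrder A
  have := CStarAlgebra.spectralOrderedRing A
  obtain ⟨y, hy⟩ := CStarAlgebra.nonneg_iff_eq_star_mul_self.1
    (sub_nonneg.2 (CStarAlgebra.star_mul_le_algebraMap_norm_sq (a := x)))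
  exact ⟨y, hy.symm⟩

theorem map_star_mul_self_le {f : StrongDual ℂ A} (hf : ∀ a, 0 ≤ f (star a * a)) (x : A) :
    (f (star x * x)).re ≤ ‖x‖ ^ 2 * (f 1).re := by
  obtain ⟨y, hy⟩ := exists_star_mul_self_eq_norm_sq_sub x
  have h := (Complex.nonneg_iff.1 (hf y)).1
  have h2 : algebraMap ℝ A (‖x‖ ^ 2) = ((‖x‖ ^ 2 : ℝ) : ℂ) • (1 : A) := by
    rw [Algebra.algebraMap_eq_smul_one, Complex.coe_smul]
  rw [hy, map_sub, h2, map_smul, Complex.sub_re, smul_eq_mul, Complex.re_ofReal_mul] at h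
  linarith

theorem norm_map_le_of_pos {f : StrongDual ℂ A} (hf : ∀ a, 0 ≤ f (star a * a)) (x : A) :
    ‖f x‖ ≤ (f 1).re * ‖x‖ := by
  have h1 := norm_map_star_mul_sq_le hf 1 x
  have h0 : 0 ≤ (f 1).re := by simpa using (Complex.nonneg_iff.1 (hf 1)).1
  have h2 := map_star_mul_self_le hf x
  simp only [star_one, one_mul] at h1
  refine le_of_sq_le_sq ?_ (by positivity)
  nlinarith

theorem mem_stateSpace_of_map_one {f : StrongDual ℂ A} (hf : ∀ a, 0 ≤ f (star a * a))
    (h1 : f 1 = 1) : f ∈ stateSpace A := by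
  refine ⟨hf, le_antisymm (f.opNorm_le_bound zero_le_one fun x => ?_) ?_⟩
  · simpa [h1] using norm_map_le_of_pos hf x
  · have h : Nontrivial A := by
      by_contra hA
      rw [not_nontrivial_iff_subsingleton] at hA
      rw [Subsingleton.elim (1 : A) 0, map_zero] at h1
      exact zero_ne_one h1
    simpa [h1] using f.le_opNorm 1

theorem map_one_of_mem_stateSpace {f : StrongDual ℂ A} (hf : f ∈ stateSpace A) : f 1 = 1 := by
  have h0 : 0 ≤ f 1 := by simpa using hf.1 1
  obtain ⟨hre, him⟩ := Complex.nonneg_iff.1 h0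
  have hle : ‖f‖ ≤ (f 1).re := f.opNorm_le_bound hre (norm_map_le_of_pos hf.1)
  have h : Nontrivial A := by
    by_contra hA
    rw [not_nontrivial_iff_subsingleton] at hA
    have : f = 0 := by ext x; rw [Subsingleton.elim x 0, map_zero, map_zero]
    simpa [this] using hf.2
  have hge : (f 1).re ≤ 1 := by
    simpa using (Complex.re_le_norm (f 1)).trans (norm_map_le_of_mem_stateSpace hf 1)
  rw [hf.2] at hle
  exact Complex.ext (le_antisymm hge hle) him.symm

theorem pos_of_norm_le_one_of_map_one {f : StrongDual ℂ A} (hf : ‖f‖ ≤ 1) (h1 : f 1 = 1) (a : A) :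
    0 ≤ f (star a * a) := by
  have hb : ∀ x, ‖f x‖ ≤ ‖x‖ := fun x => by
    simpa using (f.le_of_opNorm_le hf x)
  have hnt : Nontrivial A := by
    by_contra hA
    rw [not_nontrivial_iff_subsingleton] at hA
    rw [Subsingleton.elim (1 : A) 0, map_zero] at h1
    exact zero_ne_one h1
  set h := star a * a with hh
  have hsa : star h = h := by simp [hh]
  have him : (f h).im = 0 := by
    -- Shifting `h` by `it` moves the imaginary part of `f h` by `t`, but raises the squared norm by
    -- at most `t²`; for suitable `t` this excludes a nonzero imaginary part.
    have key : ∀ t : ℝ, ((f h).im + t) ^ 2 ≤ ‖h‖ ^ 2 + t ^ 2 := fun t => by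
      set z : A := h + ((t : ℂ) * Complex.I) • (1 : A) with hz
      have hzz : star z * z = h * h + ((t ^ 2 : ℝ) : ℂ) • (1 : A) := by
        simp only [hz, star_add, hsa, star_smul, star_one, add_mul, mul_add, smul_mul_assoc,
          mul_smul_comm, one_mul, mul_one, star_mul', Complex.star_def,
          Complex.conj_I, Complex.conj_ofReal]
        have e1 : (t : ℂ) * -Complex.I * ((t : ℂ) * Complex.I) = ((t ^ 2 : ℝ) : ℂ) := by
          push_cast
          linear_combination (-(t : ℂ) ^ 2) * Complex.I_sq
        rw [← e1]
        module
      have hn : ‖z‖ ^ 2 ≤ ‖h‖ ^ 2 + t ^ 2 := by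
        rw [sq, ← CStarRing.norm_star_mul_self, hzz]
        refine (norm_add_le _ _).trans (add_le_add ?_ ?_)
        · rw [sq]; exact norm_mul_le _ _
        · rw [norm_smul, norm_one, mul_one, Complex.norm_real, Real.norm_of_nonneg (sq_nonneg t)]
      have hfz : (f z).im = (f h).im + t := by simp [hz, h1]
      calc ((f h).im + t) ^ 2 = (f z).im ^ 2 := by rw [hfz]
        _ ≤ ‖f z‖ ^ 2 := sq_le_sq.2 (by simpa using Complex.abs_im_le_norm (f z))
        _ ≤ ‖z‖ ^ 2 := by gcongr; exact hb z
        _ ≤ _ := hn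
    by_contra hne
    have := key ((‖h‖ ^ 2 + 1) / (2 * (f h).im))
    have e : 2 * (f h).im * ((‖h‖ ^ 2 + 1) / (2 * (f h).im)) = ‖h‖ ^ 2 + 1 := by
      field_simp
    nlinarith [sq_nonneg (f h).im]
  have hre : 0 ≤ (f h).re := by
    have hnorm : ‖algebraMap ℝ A ‖h‖ - h‖ ≤ ‖h‖ := by
      let _ := CStarAlgebra.spectralOrder A
      have := CStarAlgebra.spectralOrderedRing A
      have hpos : 0 ≤ h := star_mul_self_nonneg a
      have hle : h ≤ algebraMap ℝ A ‖h‖ := IsSelfAdjoint.le_algebraMap_norm_self (a := h) hsa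
      calc ‖algebraMap ℝ A ‖h‖ - h‖ ≤ ‖algebraMap ℝ A ‖h‖‖ :=
            CStarAlgebra.norm_le_norm_of_nonneg_of_le (sub_nonneg.2 hle) (sub_le_self _ hpos)
        _ = ‖h‖ := by simp
    have h3 := (Complex.re_le_norm _).trans ((hb _).trans hnorm)
    rw [Algebra.algebraMap_eq_smul_one, ← Complex.coe_smul, map_sub, map_smul, h1] at h3
    simp at h3
    exact h3
  exact Complex.nonneg_iff.2 ⟨hre, him.symm⟩

/-- With `z = 2e² - 1`, the identity `z² + 4e(1 - e²)e = 1` bounds `z²` by `1`. This contraction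
locates `φ 1` in `exists_state_extension`. -/
theorem norm_two_smul_mul_self_sub_one_le {e : A} (he : IsSelfAdjoint e) (h1 : ‖e‖ ≤ 1) :
    ‖(2 : ℂ) • (e * e) - 1‖ ≤ 1 := by
  obtain ⟨y, hy⟩ : ∃ y : A, star y * y = 1 - e * e := by
    let _ := CStarAlgebra.spectralOrder A
    have := CStarAlgebra.spectralOrderedRing A
    have h : e * e ≤ 1 := by
      have h2 := CStarAlgebra.star_mul_le_algebraMap_norm_sq (a := e)
      rw [he.star_eq] at h2
      refine h2.trans ?_
      rw [← map_one (algebraMap ℝ A)]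
      exact algebraMap_mono A (pow_le_one₀ (norm_nonneg _) h1)
    obtain ⟨y, hy⟩ := CStarAlgebra.nonneg_iff_eq_star_mul_self.1 (sub_nonneg.2 h)
    exact ⟨y, hy.symm⟩
  set z : A := (2 : ℂ) • (e * e) - 1 with hz
  have hzs : star z = z := by simp [hz, he.star_eq]
  have hsum : star z * z + star ((2 : ℂ) • (y * e)) * ((2 : ℂ) • (y * e)) = 1 := by
    have e1 : star ((2 : ℂ) • (y * e)) * ((2 : ℂ) • (y * e)) = (4 : ℂ) • (e * (1 - e * e) * e) := by
      rw [← hy]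
      simp only [star_smul, star_mul, he.star_eq, smul_mul_assoc, mul_smul_comm, smul_smul,
        mul_assoc, Complex.star_def, map_ofNat]
      norm_num
    rw [e1, hzs, hz]
    simp only [sub_mul, mul_sub, smul_mul_assoc, mul_smul_comm, mul_one, one_mul, mul_assoc]
    module
  have hle : ‖star z * z‖ ≤ 1 := by
    let _ := CStarAlgebra.spectralOrder A
    have := CStarAlgebra.spectralOrderedRing A
    refine (CStarAlgebra.norm_le_norm_of_nonneg_of_le (b := (1 : A)) (star_mul_self_nonneg z)
      ?_).trans ?_
    · rw [← hsum]
      exact le_add_of_nonneg_right (star_mul_self_nonneg _)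
    · rcases subsingleton_or_nontrivial A with h | h
      · rw [Subsingleton.elim (1 : A) 0, norm_zero]; exact zero_le_one
      · exact norm_one.le
  rw [CStarRing.norm_star_mul_self] at hle
  nlinarith [norm_nonneg z]

/-- A positive functional dominated by a pure state is a multiple of it. -/
theorem IsPureState.eq_smul_of_le {ω f : StrongDual ℂ A} (hω : IsPureState ω)
    (hf : ∀ a, 0 ≤ f (star a * a)) (hle : ∀ a, (f (star a * a)).re ≤ (ω (star a * a)).re) (x : A) :
    f x = f 1 * ω x := by
  have hω1 := map_one_of_mem_stateSpace hω.1
  have hg : ∀ a, 0 ≤ (ω - f) (star a * a) := fun a => by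
    obtain ⟨h1, h2⟩ := Complex.nonneg_iff.1 (hf a)
    obtain ⟨h3, h4⟩ := Complex.nonneg_iff.1 (hω.1.1 a)
    exact Complex.nonneg_iff.2 ⟨by simpa using hle a, by simp [← h2, ← h4]⟩
  have hf1 : 0 ≤ f 1 := by simpa using hf 1
  obtain ⟨ht0, hti⟩ := Complex.nonneg_iff.1 hf1
  set t := (f 1).re with ht
  have hft : f 1 = (t : ℂ) := Complex.ext rfl (by simpa using hti.symm)
  have ht1 : t ≤ 1 := by simpa [hω1] using hle 1
  have hgt : (ω - f) 1 = ((1 - t : ℝ) : ℂ) := by simp [hω1, hft]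
  rcases ht0.eq_or_lt with h0 | h0
  · have := norm_map_le_of_pos hf x
    rw [← ht, ← h0, zero_mul, norm_le_zero_iff] at this
    rw [this, hft, ← h0]; simp
  rcases ht1.eq_or_lt with h1 | h1
  · have := norm_map_le_of_pos hg x
    rw [hgt, h1, sub_self, Complex.ofReal_zero, Complex.zero_re, zero_mul, norm_le_zero_iff] at this
    rw [hft, h1, Complex.ofReal_one, one_mul]
    exact (sub_eq_zero.1 this).symm
  · have hs : 0 < 1 - t := sub_pos.2 h1
    have hscale : ∀ (g : StrongDual ℂ A) (s : ℝ), 0 < s → (∀ a, 0 ≤ g (star a * a)) →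
        g 1 = s → (s⁻¹ • g : StrongDual ℂ A) ∈ stateSpace A := fun g s hs hg hgs => by
      refine mem_stateSpace_of_map_one (fun a => ?_) ?_
      · have : (0 : ℂ) ≤ (s⁻¹ : ℝ) := by exact_mod_cast (inv_pos.2 hs).le
        exact mul_nonneg this (hg a)
      · change ((s⁻¹ : ℝ) : ℂ) * g 1 = 1
        rw [hgs, ← Complex.ofReal_mul, inv_mul_cancel₀ hs.ne', Complex.ofReal_one]
    -- `ω` is the convex combination of `f / t` and `(ω - f) / (1 - t)` with weights `t` and `1 -
    -- t`.
    have hext := hω.2 (hscale f t h0 hf hft) (hscale (ω - f) (1 - t) hs hg hgt)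
      ⟨t, 1 - t, h0, hs, by ring, by
        rw [smul_smul, smul_smul, mul_inv_cancel₀ h0.ne', mul_inv_cancel₀ hs.ne', one_smul,
          one_smul, add_sub_cancel]⟩
    have h2 : f = t • ω := by
      rw [← hext, smul_smul, mul_inv_cancel₀ h0.ne', one_smul]
    rw [hft]
    exact congrArg (fun g : StrongDual ℂ A => g x) h2

end Unital

/-! ### Existence of pure states -/

section PureStates

variable {A : Type*} [NonUnitalCStarAlgebra A]

theorem WeakDual.continuousSMul_real : ContinuousSMul ℝ (WeakDual ℂ A) :=
  WeakDual.instContinuousSMul ℝ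

theorem WeakDual.locallyConvexSpace_real : LocallyConvexSpace ℝ (WeakDual ℂ A) := by
  let f : WeakDual ℂ A →ₗ[ℝ] (A → ℂ) :=
    { toFun := fun φ a => φ a, map_add' := fun _ _ => rfl, map_smul' := fun _ _ => rfl }
  exact LocallyConvexSpace.induced f

/-- The Krein–Milman theorem for the weak-* topology. -/
theorem WeakDual.closure_convexHull_extremePoints {Q : Set (WeakDual ℂ A)} (hc : IsCompact Q)
    (hconv : Convex ℝ Q) : closure (convexHull ℝ (Q.extremePoints ℝ)) = Q :=
  @_root_.closure_convexHull_extremePoints (WeakDual ℂ A) _ _ _ _ _ WeakDual.continuousSMul_real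
    WeakDual.locallyConvexSpace_real Q hc hconv

/-- A C⋆-algebra that has a state has a pure state. -/
theorem exists_isPureState (h : (stateSpace A).Nonempty) : ∃ ω : StrongDual ℂ A, IsPureState ω := by
  -- Without a unit the state space need not be weak-* compact, so Krein–Milman is applied to the
  -- positive functionals of norm at most one. A nonzero extreme point has norm one, for otherwise
  -- it lies strictly between `0` and its normalization.
  let Q : Set (WeakDual ℂ A) :=
    WeakDual.toStrongDual ⁻¹' Metric.closedBall 0 1 ∩ {f | ∀ a : A, 0 ≤ f (star a * a)}
  have hQ : ∀ f : WeakDual ℂ A, f ∈ Q ↔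
      ‖WeakDual.toStrongDual f‖ ≤ 1 ∧ ∀ a : A, 0 ≤ f (star a * a) := fun f => by
    simp [Q]
  have hcomp : IsCompact Q := by
    refine (WeakDual.isCompact_closedBall 0 1).inter_right ?_
    simp only [Set.ofPred_forall]
    exact isClosed_iInter fun a => isClosed_Ici.preimage (WeakDual.eval_continuous (star a * a))
  have hconv : Convex ℝ Q := by
    refine Convex.inter ((convex_closedBall (0 : StrongDual ℂ A) 1)) ?_
    intro f hf g hg s t hs ht _ a
    have hs' : (0 : ℂ) ≤ s := by exact_mod_cast hs
    have ht' : (0 : ℂ) ≤ t := by exact_mod_cast ht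
    exact add_nonneg (mul_nonneg hs' (hf a)) (mul_nonneg ht' (hg a))
  obtain ⟨ω₀, hω₀⟩ := h
  have hω₀Q : StrongDual.toWeakDual ω₀ ∈ Q := (hQ _).2 ⟨hω₀.2.le, hω₀.1⟩
  obtain ⟨f, hf, hf0⟩ : ∃ f ∈ Q.extremePoints ℝ, f ≠ 0 := by
    by_contra! hcon
    have h1 := WeakDual.closure_convexHull_extremePoints hcomp hconv
    have h2 : Q ⊆ {0} := by
      rw [← h1]
      refine closure_minimal (convexHull_min hcon (convex_singleton 0)) isClosed_singleton
    have h3 : ω₀ = 0 := h2 hω₀Q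
    have := hω₀.2
    rw [h3, norm_zero] at this
    exact zero_ne_one this
  set φ : StrongDual ℂ A := WeakDual.toStrongDual f with hφ
  have hφ0 : 0 < ‖φ‖ := norm_pos_iff.2 fun h => hf0 h
  have hfQ := (hQ f).1 hf.1
  have hφ1 : ‖φ‖ = 1 := by
    by_contra hne
    have hlt : ‖φ‖ < 1 := lt_of_le_of_ne hfQ.1 hne
    have hnorm : ‖(‖φ‖⁻¹ • φ : StrongDual ℂ A)‖ = 1 := by
      rw [norm_smul, norm_inv, norm_norm, inv_mul_cancel₀ hφ0.ne']
    have hmem : StrongDual.toWeakDual (‖φ‖⁻¹ • φ : StrongDual ℂ A) ∈ Q := by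
      refine (hQ _).2 ⟨hnorm.le, fun a => ?_⟩
      have : (0 : ℂ) ≤ (‖φ‖⁻¹ : ℝ) := by exact_mod_cast (inv_pos.2 hφ0).le
      exact mul_nonneg this (hfQ.2 a)
    have h0 : (0 : WeakDual ℂ A) ∈ Q := (hQ _).2 ⟨by simp, fun a => le_rfl⟩
    have := hf.2 h0 hmem ⟨1 - ‖φ‖, ‖φ‖, sub_pos.2 hlt, hφ0, by ring, by
      rw [smul_zero, zero_add]
      exact smul_inv_smul₀ hφ0.ne' φ⟩
    exact hf0 this.symm
  refine ⟨φ, ⟨hfQ.2, hφ1⟩, fun x₁ h₁ x₂ h₂ hseg => ?_⟩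
  exact hf.2 (x₁ := StrongDual.toWeakDual x₁) (x₂ := StrongDual.toWeakDual x₂)
    ((hQ _).2 ⟨h₁.2.le, h₁.1⟩) ((hQ _).2 ⟨h₂.2.le, h₂.1⟩) hseg

end PureStates

/-! ### Extension of states from subalgebras and ideals -/

section Extension

variable {E : Type*} [CStarAlgebra E]

/-- A state of a C⋆-subalgebra of a unital C⋆-algebra extends to a state. -/
theorem exists_state_extension (L : NonUnitalStarSubalgebra ℂ E) [IsClosed (L : Set E)]
    {ω : StrongDual ℂ L} (hω : ω ∈ stateSpace L) :
    ∃ φ ∈ stateSpace E, ∀ x : L, φ (x : E) = ω x := by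
  obtain ⟨φ, hφ, hn⟩ := exists_extension_norm_eq L.toSubmodule ω
  replace hφ : ∀ x : L, φ (x : E) = ω x := hφ
  have hn1 : ‖φ‖ = 1 := hn.trans hω.2
  obtain ⟨l, hl0, hl, hlx⟩ := exists_selfAdjoint_approximateUnit L
  have hlim := tendsto_state_approximateUnit hω hl hlx
  -- `2 - φ 1` is the limit of `φ` at the contractions `2e² - 1`. Together with `|φ 1| ≤ 1` this
  -- forces `φ 1 = 1`, and a functional attaining its norm at `1` is positive.
  have hle : ‖(2 : ℂ) - φ 1‖ ≤ 1 := by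
    have hlim2 : Tendsto (fun e : L => φ ((2 : ℂ) • ((e : E) * e) - 1)) l (𝓝 (2 * 1 - φ 1)) := by
      have := (hlim.const_mul (2 : ℂ)).sub_const (φ 1)
      refine this.congr fun e => ?_
      rw [map_sub, map_smul, smul_eq_mul, ← hφ]
      rfl
    rw [mul_one] at hlim2
    refine le_of_tendsto hlim2.norm (hl.mono fun e he => ?_)
    have hsa : IsSelfAdjoint (e : E) := congrArg Subtype.val he.1
    calc _ ≤ ‖φ‖ * ‖(2 : ℂ) • ((e : E) * e) - 1‖ := φ.le_opNorm _
      _ ≤ 1 := by rw [hn1, one_mul]; exact norm_two_smul_mul_self_sub_one_le hsa he.2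
  have hone : ‖φ 1‖ ≤ 1 := by
    have h1 : ‖(1 : E)‖ ≤ 1 := by
      rcases subsingleton_or_nontrivial E with h | h
      · rw [Subsingleton.elim (1 : E) 0, norm_zero]; exact zero_le_one
      · exact norm_one.le
    calc ‖φ 1‖ ≤ ‖φ‖ * ‖(1 : E)‖ := φ.le_opNorm _
      _ ≤ 1 := by rw [hn1, one_mul]; exact h1
  have hre : (φ 1).re = 1 := by
    refine le_antisymm ((Complex.re_le_norm _).trans hone) ?_
    have := (Complex.re_le_norm _).trans hle
    simp only [Complex.sub_re, Complex.re_ofNat] at this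
    linarith
  have him : (φ 1).im = 0 := by
    have h1 := Complex.sq_norm (φ 1)
    rw [Complex.normSq_apply, hre] at h1
    nlinarith [norm_nonneg (φ 1)]
  exact ⟨φ, ⟨pos_of_norm_le_one_of_map_one hn1.le (Complex.ext hre him), hn1⟩, hφ⟩

/-- States of `E` that restrict to the same state of a closed two-sided ideal are equal. -/
theorem state_ext_of_ideal (L : NonUnitalStarSubalgebra ℂ E) [IsClosed (L : Set E)]
    (hL : ∀ a ∈ L, ∀ x : E, a * x ∈ L) {ω : StrongDual ℂ L} (hω : ω ∈ stateSpace L)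
    {φ φ' : StrongDual ℂ E} (hφ : φ ∈ stateSpace E) (hφ' : φ' ∈ stateSpace E)
    (h : ∀ x : L, φ (x : E) = ω x) (h' : ∀ x : L, φ' (x : E) = ω x) : φ = φ' := by
  obtain ⟨l, hl0, hl, hlx⟩ := exists_selfAdjoint_approximateUnit L
  have hlim := tendsto_state_approximateUnit hω hl hlx
  -- Since `e²x` lies in the ideal, these limits determine `χ` from `ω`. Convergence is
  -- Cauchy–Schwarz for `1 - e²` and `x`, as `χ((1 - e²)²) ≤ 2 - 2ω(e²) → 0`.
  have key : ∀ {χ : StrongDual ℂ E}, χ ∈ stateSpace E → (∀ x : L, χ (x : E) = ω x) → ∀ x : E,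
      Tendsto (fun e : L => χ ((e : E) * e * x)) l (𝓝 (χ x)) := by
    intro χ hχ hχL x
    have hone := map_one_of_mem_stateSpace hχ
    have hb : ∀ᶠ e : L in l, ‖χ ((e : E) * e * x) - χ x‖ ^ 2 ≤
        (2 - 2 * (ω (e * e)).re) * (χ (star x * x)).re := by
      filter_upwards [hl] with e he
      have hsa : star (e : E) = e := congrArg Subtype.val he.1
      have hpos := (Complex.nonneg_iff.1 (hχ.1 x)).1
      have hcs := norm_map_star_mul_sq_le hχ.1 (1 - (e : E) * e) x
      have e1 : χ (star (1 - (e : E) * e) * x) = -(χ ((e : E) * e * x) - χ x) := by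
        simp [hsa, sub_mul]
      rw [e1, norm_neg] at hcs
      refine hcs.trans (mul_le_mul_of_nonneg_right ?_ hpos)
      have e2 : star (1 - (e : E) * e) * (1 - (e : E) * e) =
          1 - (2 : ℂ) • ((e * e : L) : E) + (e : E) * e * (e * e) := by
        have e4 : ((e * e : L) : E) = (e : E) * e := rfl
        simp only [star_sub, star_one, star_mul, hsa, sub_mul, mul_sub, one_mul, mul_one, e4]
        module
      have e3 : (χ ((e : E) * e * (e * e))).re ≤ 1 := by
        have hen : ‖(e : E)‖ ≤ 1 := he.2
        calc _ ≤ ‖χ ((e : E) * e * (e * e))‖ := Complex.re_le_norm _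
          _ ≤ ‖(e : E) * e * (e * e)‖ := norm_map_le_of_mem_stateSpace hχ _
          _ ≤ ‖(e : E)‖ * ‖(e : E)‖ * (‖(e : E)‖ * ‖(e : E)‖) :=
            (norm_mul_le _ _).trans (mul_le_mul (norm_mul_le _ _) (norm_mul_le _ _)
              (norm_nonneg _) (by positivity))
          _ ≤ 1 * 1 * (1 * 1) := by gcongr
          _ = 1 := by norm_num
      rw [e2, map_add, map_sub, hone, map_smul, hχL]
      simp only [smul_eq_mul, Complex.add_re, Complex.sub_re, Complex.one_re, Complex.mul_re,
        Complex.re_ofNat, Complex.im_ofNat, zero_mul, sub_zero]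
      linarith
    have hz : Tendsto (fun e : L => (2 - 2 * (ω (e * e)).re) * (χ (star x * x)).re) l (𝓝 0) := by
      have := (((Complex.continuous_re.tendsto 1).comp hlim).const_mul (2 : ℝ)).const_sub (2 : ℝ)
      simpa using this.mul_const (χ (star x * x)).re
    have hsq := squeeze_zero' (Eventually.of_forall fun e => sq_nonneg _) hb hz
    rw [tendsto_iff_norm_sub_tendsto_zero]
    have := hsq.sqrt
    simpa [Real.sqrt_sq] using this
  ext x
  refine tendsto_nhds_unique (key hφ h x) ((key hφ' h' x).congr fun e => ?_)
  have hmem : (e : E) * e * x ∈ L := hL _ (L.mul_mem e.2 e.2) x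
  rw [h ⟨_, hmem⟩, h' ⟨_, hmem⟩]

end Extension

/-! ### Pure states from ideal hosts -/

section Hosts

variable {F E : Type*} [CStarAlgebra F] [CStarAlgebra E]

theorem exists_pullback_state (ξ : F →⋆ₐ[ℂ] E) {φ : StrongDual ℂ E} (hφ : φ ∈ stateSpace E) :
    ∃ ψ ∈ stateSpace F, ∀ f, ψ f = φ (ξ f) := by
  let Ξ : F →L[ℂ] E := ⟨ξ.toAlgHom.toLinearMap, AddMonoidHomClass.continuous_of_bound ξ 1 fun a => by
    simpa using NonUnitalStarAlgHom.norm_apply_le ξ a⟩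
  refine ⟨φ.comp Ξ, mem_stateSpace_of_map_one (fun a => ?_) ?_, fun f => rfl⟩
  · change 0 ≤ φ (ξ (star a * a))
    rw [map_mul, map_star]
    exact hφ.1 _
  · change φ (ξ 1) = 1
    rw [map_one, map_one_of_mem_stateSpace hφ]

/-- If a nonempty extreme subset of the state space has an ideal host, it contains a pure state. -/
theorem IsIdealHost.exists_isPureState {S₀ : Set (StrongDual ℂ F)}
    {L : NonUnitalStarSubalgebra ℂ E} {ξ : F →⋆ₐ[ℂ] E} (h : IsIdealHost S₀ L ξ)
    (hne : S₀.Nonempty) (hext : IsExtreme ℝ (stateSpace F) S₀) : ∃ ψ ∈ S₀, IsPureState ψ := by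
  have hcl : IsClosed (L : Set E) := h.isClosed
  have hideal : ∀ a ∈ L, ∀ x : E, a * x ∈ L := fun a ha x => (h.ideal a ha x).2
  obtain ⟨ω, hω⟩ : ∃ ω : StrongDual ℂ L, IsPureState ω := by
    obtain ⟨ψ, hψ⟩ := hne
    rw [← h.range_eq] at hψ
    obtain ⟨ω, hω, -⟩ := hψ
    exact _root_.exists_isPureState ⟨ω, hω⟩
  obtain ⟨φ, hφ, hφω⟩ := exists_state_extension L hω.1
  obtain ⟨ψ, hψ, hψφ⟩ := exists_pullback_state ξ hφ
  have hψ₀ : ψ ∈ S₀ := by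
    rw [← h.range_eq]
    exact ⟨ω, hω.1, φ, hφ, hφω, hψφ⟩
  refine ⟨ψ, hψ₀, hψ, fun ψ₁ h₁ ψ₂ h₂ hseg => ?_⟩
  have h₁₀ := hext.2 h₁ h₂ hψ₀ hseg
  have h₂₀ := hext.2 h₂ h₁ hψ₀ (openSegment_symm ℝ ψ₁ ψ₂ ▸ hseg)
  rw [← h.range_eq] at h₁₀ h₂₀
  obtain ⟨ω₁, hω₁, φ₁, hφ₁, hφω₁, hψφ₁⟩ := h₁₀
  obtain ⟨ω₂, hω₂, φ₂, hφ₂, hφω₂, hψφ₂⟩ := h₂₀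
  obtain ⟨s, t, hs, ht, hst, hsum⟩ := hseg
  have hω' := convex_stateSpace L hω₁ hω₂ hs.le ht.le hst
  -- Both sides are states of `L` with image `ψ`, so injectivity of the extension map applies.
  have heq : s • ω₁ + t • ω₂ = ω := by
    refine h.injective _ hω' _ hω.1 ψ ⟨s • φ₁ + t • φ₂,
      convex_stateSpace E hφ₁ hφ₂ hs.le ht.le hst, fun x => ?_, fun f => ?_⟩
      ⟨φ, hφ, hφω, hψφ⟩
    · simp [hφω₁, hφω₂]
    · simp [← hsum, hψφ₁, hψφ₂]
  have hω₁ω : ω₁ = ω := hω.2 hω₁ hω₂ ⟨s, t, hs, ht, hst, heq⟩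
  subst hω₁ω
  have hφφ := state_ext_of_ideal L hideal hω₁ hφ₁ hφ hφω₁ hφω
  ext f
  rw [hψφ₁, hψφ, hφφ]

end Hosts

/-! ### Order, monotone suprema and normal states of von Neumann algebras -/

theorem ContinuousLinearMap.nonneg_iff_inner {H : Type*} [NormedAddCommGroup H]
    [InnerProductSpace ℂ H] (T : H →L[ℂ] H) : 0 ≤ T ↔ ∀ ξ, 0 ≤ inner ℂ (T ξ) ξ := by
  rw [ContinuousLinearMap.nonneg_iff_isPositive, ContinuousLinearMap.isPositive_iff_complex]
  refine forall_congr' fun ξ => ?_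
  rw [Complex.nonneg_iff]
  refine ⟨fun h => ⟨h.2, ?_⟩, fun h => ⟨Complex.ext rfl ?_, h.1⟩⟩
  · rw [← h.1]; exact (Complex.ofReal_im _).symm
  · rw [← h.2]; exact Complex.ofReal_im _

theorem exists_tendsto_of_norm_le {α : Type*} (U : Ultrafilter α) {f : α → ℂ} {C : ℝ}
    (hf : ∀ᶠ x in U, ‖f x‖ ≤ C) : ∃ z, Tendsto f U (𝓝 z) := by
  obtain ⟨z, -, hz⟩ := (isCompact_closedBall (0 : ℂ) C).ultrafilter_le_nhds (U.map f)
    (le_principal_iff.2 (by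
      change ∀ᶠ x in U, f x ∈ Metric.closedBall 0 C
      simpa using hf))
  exact ⟨z, hz⟩

/-- A directed set is eventually above each of its elements along some ultrafilter on it. -/
theorem DirectedOn.exists_ultrafilter {α : Type*} [Preorder α] {D : Set α} (hne : D.Nonempty)
    (hD : DirectedOn (· ≤ ·) D) :
    ∃ U : Ultrafilter α, (∀ᶠ x in U, x ∈ D) ∧ ∀ x₀ ∈ D, ∀ᶠ x in U, x₀ ≤ x := by
  have := hne.to_subtype
  have : IsDirectedOrder D := ⟨fun x y => by
    obtain ⟨z, hz, hxz, hyz⟩ := hD x x.2 y y.2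
    exact ⟨⟨z, hz⟩, hxz, hyz⟩⟩
  refine ⟨(Ultrafilter.of (atTop : Filter D)).map Subtype.val, ?_, fun x₀ hx₀ => ?_⟩
  · change ∀ᶠ x : D in (Ultrafilter.of (atTop : Filter D) : Filter D), (x : α) ∈ D
    exact Eventually.of_forall fun x => x.2
  · exact (Ultrafilter.of_le (atTop : Filter D)) (eventually_ge_atTop (⟨x₀, hx₀⟩ : D))

namespace VonNeumannAlgebra

variable {H : Type*} [NormedAddCommGroup H] [InnerProductSpace ℂ H] [CompleteSpace H]
  (N : VonNeumannAlgebra H)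

theorem mem_of_forall_commute {x : H →L[ℂ] H} (h : ∀ y ∈ N.commutant, Commute y x) : x ∈ N := by
  rw [← N.commutant_commutant, mem_commutant_iff]
  exact h

theorem commute_of_mem_commutant {x y : H →L[ℂ] H} (hx : x ∈ N) (hy : y ∈ N.commutant) :
    Commute y x :=
  (mem_commutant_iff.1 hy x hx).symm

variable {N}

theorem nonneg_iff_inner (x : N) : 0 ≤ x ↔ ∀ ξ, 0 ≤ inner ℂ ((x : H →L[ℂ] H) ξ) ξ :=
  ContinuousLinearMap.nonneg_iff_inner (x : H →L[ℂ] H)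

theorem le_iff_sub_nonneg (x y : N) : x ≤ y ↔ 0 ≤ y - x :=
  (sub_nonneg (a := (y : H →L[ℂ] H)) (b := x)).symm

theorem le_iff_inner (x y : N) :
    x ≤ y ↔ ∀ ξ, 0 ≤ inner ℂ ((y : H →L[ℂ] H) ξ - (x : H →L[ℂ] H) ξ) ξ := by
  rw [le_iff_sub_nonneg, nonneg_iff_inner]
  rfl

/-- Positive elements of a von Neumann algebra have a square root in it. -/
theorem exists_isSelfAdjoint_mul_self_eq {x : N} (hx : 0 ≤ x) :
    ∃ b : N, IsSelfAdjoint b ∧ b * b = x := by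
  have hx' : 0 ≤ (x : H →L[ℂ] H) := hx
  -- Functional calculus preserves commutation with `N'`, and `N` is its own bicommutant.
  have hmem : CFC.sqrt (x : H →L[ℂ] H) ∈ N := N.mem_of_forall_commute fun y hy =>
    ((N.commute_of_mem_commutant x.2 hy).symm.cfcₙ_nnreal NNReal.sqrt).symm
  refine ⟨⟨CFC.sqrt (x : H →L[ℂ] H), hmem⟩, ?_, ?_⟩
  · exact Subtype.ext (CFC.sqrt_nonneg (x : H →L[ℂ] H)).isSelfAdjoint
  · exact Subtype.ext (CFC.sqrt_mul_sqrt_self (x : H →L[ℂ] H) hx')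

theorem star_mul_self_nonneg (x : N) : 0 ≤ star x * x :=
  _root_.star_mul_self_nonneg (x : H →L[ℂ] H)

theorem map_nonneg {ω : StrongDual ℂ N} (hω : ∀ a, 0 ≤ ω (star a * a)) {x : N} (hx : 0 ≤ x) :
    0 ≤ ω x := by
  obtain ⟨b, hb, rfl⟩ := exists_isSelfAdjoint_mul_self_eq hx
  simpa [hb.star_eq] using hω b

theorem map_re_mono {ω : StrongDual ℂ N} (hω : ∀ a, 0 ≤ ω (star a * a)) {x y : N} (h : x ≤ y) :
    (ω x).re ≤ (ω y).re := by
  have := (Complex.nonneg_iff.1 (map_nonneg hω ((le_iff_sub_nonneg x y).1 h))).1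
  rw [map_sub, Complex.sub_re] at this
  linarith

/-- The vector functional `x ↦ ⟪ξ, x ξ⟫`. -/
noncomputable def vectorFunctional (N : VonNeumannAlgebra H) (ξ : H) : StrongDual ℂ N :=
  LinearMap.mkContinuous
    { toFun := fun x => inner ℂ ξ ((x : H →L[ℂ] H) ξ)
      map_add' := fun x y => inner_add_right _ _ _
      map_smul' := fun c x => inner_smul_right _ _ _ } (‖ξ‖ ^ 2) fun x => by
    calc _ ≤ ‖ξ‖ * ‖(x : H →L[ℂ] H) ξ‖ := norm_inner_le_norm _ _
      _ ≤ ‖ξ‖ * (‖(x : H →L[ℂ] H)‖ * ‖ξ‖) := by gcongr; exact (x : H →L[ℂ] H).le_opNorm ξ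
      _ = ‖ξ‖ ^ 2 * ‖x‖ := by rw [show ‖x‖ = ‖(x : H →L[ℂ] H)‖ from rfl]; ring

theorem vectorFunctional_apply (ξ : H) (x : N) :
    N.vectorFunctional ξ x = inner ℂ ξ ((x : H →L[ℂ] H) ξ) := rfl

theorem vectorFunctional_star_mul_self (ξ : H) (x : N) :
    N.vectorFunctional ξ (star x * x) = ((‖(x : H →L[ℂ] H) ξ‖ ^ 2 : ℝ) : ℂ) := by
  change inner ℂ ξ ((star (x : H →L[ℂ] H)) ((x : H →L[ℂ] H) ξ)) = _
  rw [ContinuousLinearMap.star_eq_adjoint, ContinuousLinearMap.adjoint_inner_right,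
    inner_self_eq_norm_sq_to_K]
  simp

theorem vectorFunctional_pos (ξ : H) (x : N) : 0 ≤ N.vectorFunctional ξ (star x * x) := by
  rw [vectorFunctional_star_mul_self]
  exact_mod_cast sq_nonneg ‖(x : H →L[ℂ] H) ξ‖

/-- A norm bounded upward directed set in a von Neumann algebra has a supremum, and vector
functionals preserve it. -/
theorem exists_isLUB_of_norm_le {D : Set N} (hne : D.Nonempty) (hD : DirectedOn (· ≤ ·) D) {C : ℝ}
    (hC : ∀ x ∈ D, ‖x‖ ≤ C) : ∃ s : N, IsLUB D s ∧ ∀ ξ : H,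
      IsLUB ((fun x => (N.vectorFunctional ξ x).re) '' D) (N.vectorFunctional ξ s).re := by
  obtain ⟨U, hUD, hU⟩ := hD.exists_ultrafilter hne
  have hbd : ∀ᶠ x : N in U, ∀ v w : H, ‖inner ℂ ((x : H →L[ℂ] H) v) w‖ ≤ C * ‖v‖ * ‖w‖ := by
    filter_upwards [hUD] with x hx v w
    calc _ ≤ ‖(x : H →L[ℂ] H) v‖ * ‖w‖ := norm_inner_le_norm _ _
      _ ≤ ‖(x : H →L[ℂ] H)‖ * ‖v‖ * ‖w‖ := by gcongr; exact (x : H →L[ℂ] H).le_opNorm v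
      _ ≤ _ := by gcongr; exact hC x hx
  have hex : ∀ v w : H, ∃ z, Tendsto (fun x : N => inner ℂ ((x : H →L[ℂ] H) v) w) U (𝓝 z) :=
    fun v w => exists_tendsto_of_norm_le U (hbd.mono fun x hx => hx v w)
  choose B hB using hex
  -- The ultrafilter limits of the matrix coefficients form a bounded sesquilinear form; the
  -- operator `T` representing it is the supremum.
  let B₀ : H →ₗ⋆[ℂ] H →ₗ[ℂ] ℂ := LinearMap.mk₂'ₛₗ (starRingEnd ℂ) (RingHom.id ℂ) B
    (fun v v' w => tendsto_nhds_unique (hB _ _) (((hB v w).add (hB v' w)).congr fun x => by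
      rw [map_add, inner_add_left]))
    (fun c v w => tendsto_nhds_unique (hB _ _) (((hB v w).const_mul _).congr fun x => by
      rw [map_smul, inner_smul_left]))
    (fun v w w' => tendsto_nhds_unique (hB _ _) (((hB v w).add (hB v w')).congr fun x => by
      rw [inner_add_right]))
    (fun c v w => tendsto_nhds_unique (hB _ _) (((hB v w).const_mul _).congr fun x => by
      rw [inner_smul_right]; rfl))
  let T : H →L[ℂ] H := InnerProductSpace.continuousLinearMapOfBilin
    (B₀.mkContinuous₂ C fun v w => le_of_tendsto (hB v w).norm (hbd.mono fun x hx => hx v w))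
  have hT : ∀ v w, inner ℂ (T v) w = B v w := fun v w =>
    InnerProductSpace.continuousLinearMapOfBilin_apply _ v w
  have hlim : ∀ v w, Tendsto (fun x : N => inner ℂ ((x : H →L[ℂ] H) v) w) U
      (𝓝 (inner ℂ (T v) w)) := fun v w => by rw [hT]; exact hB v w
  have hTN : T ∈ N := N.mem_of_forall_commute fun y hy => by
    ext v
    refine ext_inner_right ℂ fun w => ?_
    change inner ℂ (y (T v)) w = inner ℂ (T (y v)) w
    rw [← ContinuousLinearMap.adjoint_inner_right]
    refine tendsto_nhds_unique (hlim v _) ((hlim (y v) w).congr fun x => ?_)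
    rw [ContinuousLinearMap.adjoint_inner_right]
    have := congrArg (fun S : H →L[ℂ] H => S v) (N.commute_of_mem_commutant x.2 hy).eq
    change y ((x : H →L[ℂ] H) v) = (x : H →L[ℂ] H) (y v) at this
    rw [this]
  have hub : ∀ x ∈ D, x ≤ (⟨T, hTN⟩ : N) := fun x hx => by
    rw [le_iff_inner]
    intro ξ
    have h1 : Tendsto (fun y : N => inner ℂ ((y : H →L[ℂ] H) ξ - (x : H →L[ℂ] H) ξ) ξ) U
        (𝓝 (inner ℂ (T ξ - (x : H →L[ℂ] H) ξ) ξ)) := by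
      simp only [inner_sub_left]
      exact (hlim ξ ξ).sub_const _
    exact ge_of_tendsto h1 ((hU x hx).mono fun y hy => (le_iff_inner x y).1 hy ξ)
  refine ⟨⟨T, hTN⟩, ⟨hub, fun u hu => ?_⟩, fun ξ => ⟨?_, fun u hu => ?_⟩⟩
  · rw [le_iff_inner]
    intro ξ
    have h1 : Tendsto (fun y : N => inner ℂ ((u : H →L[ℂ] H) ξ - (y : H →L[ℂ] H) ξ) ξ) U
        (𝓝 (inner ℂ ((u : H →L[ℂ] H) ξ - T ξ) ξ)) := by
      simp only [inner_sub_left]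
      exact (hlim ξ ξ).const_sub _
    exact ge_of_tendsto h1 (hUD.mono fun y hy => (le_iff_inner y u).1 (hu hy) ξ)
  · rintro _ ⟨x, hx, rfl⟩
    exact map_re_mono (vectorFunctional_pos ξ) (hub x hx)
  · have h1 : Tendsto (fun y : N => (N.vectorFunctional ξ y).re) U
        (𝓝 (N.vectorFunctional ξ ⟨T, hTN⟩).re) := by
      have := (Complex.continuous_re.tendsto _).comp (hlim ξ ξ)
      refine (this.congr fun y => ?_).trans (le_of_eq ?_)
      · exact inner_re_symm (𝕜 := ℂ) _ _
      · congr 1; exact inner_re_symm (𝕜 := ℂ) _ _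
    exact le_of_tendsto h1 (hUD.mono fun y hy => hu ⟨y, hy, rfl⟩)

theorem norm_le_norm_of_nonneg_of_le {x y : N} (hx : 0 ≤ x) (hxy : x ≤ y) : ‖x‖ ≤ ‖y‖ :=
  CStarAlgebra.norm_le_norm_of_nonneg_of_le (a := (x : H →L[ℂ] H)) (b := y) hx hxy

theorem norm_le_of_mem_Icc {x₀ x a : N} (h : x₀ ≤ x) (h' : x ≤ a) : ‖x‖ ≤ ‖a - x₀‖ + ‖x₀‖ := by
  have h1 : ‖x - x₀‖ ≤ ‖a - x₀‖ := by
    refine norm_le_norm_of_nonneg_of_le ((le_iff_sub_nonneg _ _).1 h) ?_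
    rw [le_iff_sub_nonneg, sub_sub_sub_cancel_right, ← le_iff_sub_nonneg]
    exact h'
  calc ‖x‖ = ‖x - x₀ + x₀‖ := by rw [sub_add_cancel]
    _ ≤ ‖x - x₀‖ + ‖x₀‖ := norm_add_le _ _
    _ ≤ _ := by gcongr

theorem directedOn_inter_Ici {α : Type*} [Preorder α] {D : Set α} (hD : DirectedOn (· ≤ ·) D)
    (x₀ : α) : DirectedOn (· ≤ ·) (D ∩ Set.Ici x₀) := by
  rintro x ⟨hx, hx₀⟩ y ⟨hy, -⟩
  obtain ⟨z, hz, hxz, hyz⟩ := hD x hx y hy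
  exact ⟨z, ⟨hz, hx₀.trans hxz⟩, hxz, hyz⟩

theorem isLUB_image_inter_Ici_iff {α β : Type*} [Preorder α] [Preorder β] {D : Set α}
    (hD : DirectedOn (· ≤ ·) D) {x₀ : α} (hx₀ : x₀ ∈ D) {f : α → β} (hf : Monotone f) (b : β) :
    IsLUB (f '' (D ∩ Set.Ici x₀)) b ↔ IsLUB (f '' D) b := by
  have : upperBounds (f '' (D ∩ Set.Ici x₀)) = upperBounds (f '' D) := by
    refine Set.Subset.antisymm ?_ (upperBounds_mono_set (Set.image_mono Set.inter_subset_left))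
    rintro u hu _ ⟨x, hx, rfl⟩
    obtain ⟨z, hz, hxz, h₀z⟩ := hD x hx x₀ hx₀
    exact (hf hxz).trans (hu ⟨z, ⟨hz, h₀z⟩, rfl⟩)
  rw [IsLUB, this, IsLUB]

/-- Only the part of `D` above a fixed `x₀ ∈ D` matters, and it lies in the norm bounded order
interval from `x₀` to `a`. -/
theorem isNormal_of_forall_norm_le {ω : StrongDual ℂ N} (hω : ∀ a, 0 ≤ ω (star a * a))
    (h : ∀ D : Set N, D.Nonempty → DirectedOn (· ≤ ·) D → ∀ C : ℝ, (∀ x ∈ D, ‖x‖ ≤ C) →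
      ∀ a : N, IsLUB D a → IsLUB ((fun x : N => (ω x).re) '' D) (ω a).re) : N.IsNormal ω := by
  intro D hne hD _ a ha
  obtain ⟨x₀, hx₀⟩ := hne
  have hmono : Monotone fun x : N => (ω x).re := fun x y hxy => map_re_mono hω hxy
  rw [← isLUB_image_inter_Ici_iff hD hx₀ hmono]
  refine h (D ∩ Set.Ici x₀) ⟨x₀, hx₀, le_refl x₀⟩ (directedOn_inter_Ici hD x₀) (‖a - x₀‖ + ‖x₀‖)
    (fun x hx => norm_le_of_mem_Icc hx.2 (ha.1 hx.1)) a ?_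
  have := isLUB_image_inter_Ici_iff hD hx₀ monotone_id a
  rw [Set.image_id, Set.image_id] at this
  exact this.2 ha

theorem isNormal_vectorFunctional (ξ : H) : N.IsNormal (N.vectorFunctional ξ) := by
  refine isNormal_of_forall_norm_le (vectorFunctional_pos ξ) fun D hne hD C hC a ha => ?_
  obtain ⟨s, hs, hsξ⟩ := exists_isLUB_of_norm_le hne hD hC
  rw [ha.unique hs]
  exact hsξ ξ

theorem normalStates_nonempty [Nontrivial N] : N.normalStates.Nonempty := by
  have : Nontrivial H := by
    by_contra hH
    rw [not_nontrivial_iff_subsingleton] at hH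
    refine zero_ne_one (α := N) (Subtype.ext ?_)
    exact Subsingleton.elim (0 : H →L[ℂ] H) 1
  obtain ⟨ζ, hζ⟩ := exists_ne (0 : H)
  refine ⟨N.vectorFunctional ((‖ζ‖⁻¹ : ℂ) • ζ), mem_stateSpace_of_map_one (vectorFunctional_pos _) ?_,
    isNormal_vectorFunctional _⟩
  rw [vectorFunctional_apply]
  change inner ℂ ((‖ζ‖⁻¹ : ℂ) • ζ) ((‖ζ‖⁻¹ : ℂ) • ζ) = 1
  rw [inner_self_eq_norm_sq_to_K]
  simp [norm_smul, hζ]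

/-- The normal states form a face of the state space. -/
theorem isExtreme_normalStates : IsExtreme ℝ (stateSpace N) N.normalStates := by
  refine ⟨fun ω hω => hω.1, ?_⟩
  rintro ψ₁ h₁ ψ₂ h₂ ψ hψ ⟨s, t, hs, ht, hst, rfl⟩
  refine ⟨h₁, fun D hne hD hsa a ha => ⟨?_, fun u hu => ?_⟩⟩
  · rintro _ ⟨x, hx, rfl⟩
    exact map_re_mono h₁.1 (ha.1 hx)
  · have hlub := hψ.2 D hne hD hsa a ha
    have hval : ∀ x : N, ((s • ψ₁ + t • ψ₂ : StrongDual ℂ N) x).re =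
        s * (ψ₁ x).re + t * (ψ₂ x).re := fun x => by simp
    simp only [hval] at hlub
    -- Bounding the `ψ₂` term by its value at `a` lets it cancel, which leaves `ψ₁ a ≤ u` because `s
    -- > 0`.
    have hle : s * (ψ₁ a).re + t * (ψ₂ a).re ≤ s * u + t * (ψ₂ a).re := by
      refine hlub.2 ?_
      rintro _ ⟨x, hx, rfl⟩
      have h1 : (ψ₁ x).re ≤ u := hu ⟨x, hx, rfl⟩
      have h2 := map_re_mono h₂.1 (ha.1 hx)
      dsimp only
      gcongr
    nlinarith

/-- All states of a finite-dimensional von Neumann algebra are normal. -/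
theorem normalStates_eq_of_finiteDimensional [FiniteDimensional ℂ N] :
    N.normalStates = stateSpace N := by
  refine Set.Subset.antisymm (fun ω hω => hω.1) fun ω hω => ⟨hω, ?_⟩
  refine isNormal_of_forall_norm_le hω.1 fun D hne hD C hC a ha => ?_
  obtain ⟨U, hUD, hU⟩ := hD.exists_ultrafilter hne
  -- Compact balls give a norm limit `b` of `D`. It is the supremum, and continuity of `ω` suffices.
  have : ProperSpace N := FiniteDimensional.proper ℂ N
  obtain ⟨b, -, hb⟩ := (isCompact_closedBall (0 : N) C).ultrafilter_le_nhds U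
    (le_principal_iff.2 (hUD.mono fun x hx => by simpa using hC x hx))
  have hin : ∀ ξ : H, Tendsto (fun x : N => inner ℂ ((x : H →L[ℂ] H) ξ) ξ) U
      (𝓝 (inner ℂ ((b : H →L[ℂ] H) ξ) ξ)) := fun ξ => by
    have : Continuous fun x : N => inner ℂ ((x : H →L[ℂ] H) ξ) ξ := by fun_prop
    exact (this.tendsto b).mono_left hb
  have hub : b ∈ upperBounds D := fun x hx => by
    rw [le_iff_inner]
    intro ξ
    rw [inner_sub_left]
    refine ge_of_tendsto ((hin ξ).sub_const _) ((hU x hx).mono fun y hy => ?_)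
    rw [← inner_sub_left]
    exact (le_iff_inner x y).1 hy ξ
  have hlb : b ≤ a := by
    rw [le_iff_inner]
    intro ξ
    rw [inner_sub_left]
    refine ge_of_tendsto ((hin ξ).const_sub _) (hUD.mono fun y hy => ?_)
    rw [← inner_sub_left]
    exact (le_iff_inner y a).1 (ha.1 hy) ξ
  have hab : a = b := le_antisymm (ha.2 hub) hlb
  subst hab
  refine ⟨?_, fun u hu => ?_⟩
  · rintro _ ⟨x, hx, rfl⟩
    exact map_re_mono hω.1 (ha.1 hx)
  · have h1 : Tendsto (fun x => (ω x).re) U (𝓝 (ω a).re) :=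
      ((Complex.continuous_re.comp ω.continuous).tendsto a).mono_left hb
    exact le_of_tendsto h1 (hUD.mono fun x hx => hu ⟨x, hx, rfl⟩)

end VonNeumannAlgebra

/-! ### Simple algebras with a minimal projection -/

section Simple

variable {A : Type*} [CStarAlgebra A]

/-- The closed two-sided ideal generated by an element. -/
noncomputable def closedIdealSpan (p : A) : TwoSidedIdeal A :=
  TwoSidedIdeal.mk' ((Submodule.span ℂ {z : A | ∃ a b, z = a * p * b}).topologicalClosure : Set A)
    (Submodule.zero_mem _) (Submodule.add_mem _) (Submodule.neg_mem _)
    (fun {x y} hy => by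
      refine map_mem_closure (f := fun y => x * y) (by fun_prop) hy fun z hz => ?_
      induction hz using Submodule.span_induction with
      | mem z hz =>
        obtain ⟨a, b, rfl⟩ := hz
        exact Submodule.subset_span ⟨x * a, b, by simp only [mul_assoc]⟩
      | zero => simp
      | add u v _ _ hu hv => simpa [mul_add] using Submodule.add_mem _ hu hv
      | smul c u _ hu => simpa using Submodule.smul_mem _ c hu)
    (fun {x y} hx => by
      refine map_mem_closure (f := fun x => x * y) (by fun_prop) hx fun z hz => ?_
      induction hz using Submodule.span_induction with
      | mem z hz =>
        obtain ⟨a, b, rfl⟩ := hz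
        exact Submodule.subset_span ⟨a, b * y, by simp only [mul_assoc]⟩
      | zero => simp
      | add u v _ _ hu hv => simpa [add_mul] using Submodule.add_mem _ hu hv
      | smul c u _ hu => simpa using Submodule.smul_mem _ c hu)

theorem coe_closedIdealSpan (p : A) : (closedIdealSpan p : Set A) =
    closure (Submodule.span ℂ {z : A | ∃ a b, z = a * p * b}) :=
  Set.ext fun x => TwoSidedIdeal.mem_mk' _ _ _ _ _ _ x

/-- A simple unital C⋆-algebra with a nonzero element `p` such that `p A p ⊆ ℂ p` is
finite-dimensional. -/
theorem IsSimpleCStarAlgebra.finiteDimensional (hA : IsSimpleCStarAlgebra A) {p : A} (hp : p ≠ 0)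
    (c : A → ℂ) (hc : ∀ y, p * y * p = c y • p) : FiniteDimensional ℂ A := by
  set V := Submodule.span ℂ {z : A | ∃ a b, z = a * p * b} with hV
  have hcl := coe_closedIdealSpan p
  have htop : closedIdealSpan p = ⊤ := by
    refine (hA.2 _ (hcl ▸ isClosed_closure)).resolve_left fun hbot => hp ?_
    have : p ∈ (closedIdealSpan p : Set A) := by
      rw [hcl]
      exact subset_closure (Submodule.subset_span ⟨1, 1, by simp⟩)
    rw [hbot] at this
    simpa using this
  have h1 : (1 : A) ∈ closure (V : Set A) := by
    rw [← hcl, htop]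
    trivial
  obtain ⟨s, hs, hs1⟩ := Metric.mem_closure_iff.1 h1 1 one_pos
  obtain ⟨u, hu⟩ : IsUnit s := by
    have : ‖1 - s‖ < 1 := by rwa [← dist_eq_norm]
    simpa using isUnit_one_sub_of_norm_lt_one this
  obtain ⟨T, hT, hsT⟩ := Submodule.mem_span_finite_of_mem_span hs
  have hchoose : ∀ z, ∃ a b, z ∈ (T : Set A) → z = a * p * b := fun z => by
    by_cases hz : z ∈ (T : Set A)
    · obtain ⟨a, b, hab⟩ := hT hz
      exact ⟨a, b, fun _ => hab⟩
    · exact ⟨0, 0, fun h => absurd h hz⟩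
  choose α β hαβ using hchoose
  set W := Submodule.span ℂ (Set.image2 (fun z w => α z * p * β w) (T : Set A) (T : Set A)) with hW
  have hfin : FiniteDimensional ℂ W :=
    FiniteDimensional.span_of_finite ℂ (T.finite_toSet.image2 _ T.finite_toSet)
  -- In `(a p b) x (a' p b')` the middle factor `p (b x a') p` is a multiple of `p`, so only the
  -- finitely many products `a p b'` remain.
  have hmem : ∀ x, ∀ v ∈ Submodule.span ℂ (T : Set A), ∀ w ∈ Submodule.span ℂ (T : Set A),
      v * x * w ∈ W := fun x v hv w hw => by
    induction hv using Submodule.span_induction with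
    | mem z hz =>
      induction hw using Submodule.span_induction with
      | mem w hw =>
        have e : z * x * w = c (β z * x * α w) • (α z * p * β w) := calc
          _ = (α z * p * β z) * x * (α w * p * β w) := by rw [← hαβ z hz, ← hαβ w hw]
          _ = α z * (p * (β z * x * α w) * p) * β w := by simp only [mul_assoc]
          _ = _ := by rw [hc, mul_smul_comm, smul_mul_assoc]
        rw [e]
        exact Submodule.smul_mem _ _ (Submodule.subset_span ⟨z, hz, w, hw, rfl⟩)
      | zero => simp
      | add u v _ _ hu hv => simpa [mul_add] using Submodule.add_mem _ hu hv
      | smul k u _ hu => simpa using Submodule.smul_mem _ k hu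
    | zero => simp
    | add u v _ _ hu hv => simpa [add_mul] using Submodule.add_mem _ hu hv
    | smul k u _ hu => simpa using Submodule.smul_mem _ k hu
  -- Every `x` equals `s (s⁻¹ x s⁻¹) s` with `s` invertible in the span of `T`.
  have hWtop : W = ⊤ := by
    refine eq_top_iff.2 fun x _ => ?_
    have := hmem (↑u⁻¹ * x * ↑u⁻¹) s hsT s hsT
    rwa [← hu, show (u : A) * (↑u⁻¹ * x * ↑u⁻¹) * u = x by
      rw [mul_assoc, mul_assoc, Units.inv_mul, mul_one, Units.mul_inv_cancel_left]] at this
  rw [hWtop] at hfin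
  exact Module.finite_def.2 (Submodule.fg_top _ |>.1 (Module.finite_def.1 hfin))

end Simple

/-! ### Domination by vector functionals and normal pure states -/

theorem IsPureState.eq_smul_of_le_mul {A : Type*} [CStarAlgebra A] {ω f : StrongDual ℂ A}
    (hω : IsPureState ω) (hf : ∀ a, 0 ≤ f (star a * a)) {C : ℝ} (hC : 0 < C)
    (hle : ∀ a, (f (star a * a)).re ≤ C * (ω (star a * a)).re) (x : A) : f x = f 1 * ω x := by
  have hC' : (0 : ℂ) < C := by exact_mod_cast hC
  have h := hω.eq_smul_of_le (f := (((C⁻¹ : ℝ) : ℂ) • f))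
    (fun a => mul_nonneg (by exact_mod_cast (inv_pos.2 hC).le) (hf a)) (fun a => by
      change (((C⁻¹ : ℝ) : ℂ) * f (star a * a)).re ≤ _
      rw [Complex.re_ofReal_mul, inv_mul_le_iff₀ hC]
      exact hle a) x
  change ((C⁻¹ : ℝ) : ℂ) * f x = ((C⁻¹ : ℝ) : ℂ) * f 1 * ω x at h
  rw [mul_assoc] at h
  exact mul_left_cancel₀ (by exact_mod_cast (inv_pos.2 hC).ne') h

/-- A linear functional dominated by the norm of a linear map into a Hilbert space is an inner
product with a vector in the closed range of that map. -/
theorem exists_inner_eq_of_norm_le {V H : Type*} [AddCommGroup V] [Module ℂ V]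
    [NormedAddCommGroup H] [InnerProductSpace ℂ H] [CompleteSpace H] (G : V →ₗ[ℂ] H)
    (F : V →ₗ[ℂ] ℂ) (h : ∀ x, ‖F x‖ ≤ ‖G x‖) :
    ∃ ζ ∈ closure (Set.range G), ∀ x, F x = inner ℂ ζ (G x) := by
  have hwd : ∀ x y, G x = G y → F x = F y := fun x y hxy => by
    have := h (x - y)
    rw [map_sub, map_sub, hxy, sub_self, norm_zero, norm_le_zero_iff] at this
    exact sub_eq_zero.1 this
  have hch : ∀ w : LinearMap.range G, G w.2.choose = w := fun w => w.2.choose_spec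
  let f₀ : LinearMap.range G →ₗ[ℂ] ℂ :=
    { toFun := fun w => F w.2.choose
      map_add' := fun v w => by
        rw [← map_add]
        exact hwd _ _ (by rw [map_add, hch, hch, hch]; rfl)
      map_smul' := fun c w => by
        rw [RingHom.id_apply, ← map_smul]
        exact hwd _ _ (by rw [map_smul, hch, hch]; rfl) }
  let f : StrongDual ℂ (LinearMap.range G) := f₀.mkContinuous 1 fun w => by
    rw [one_mul]
    exact (h _).trans (by rw [hch]; rfl)
  obtain ⟨g, hg, -⟩ := exists_extension_norm_eq (LinearMap.range G) f
  set K := (LinearMap.range G).topologicalClosure with hK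
  refine ⟨K.starProjection ((InnerProductSpace.toDual ℂ H).symm g), ?_, fun x => ?_⟩
  · exact Submodule.starProjection_apply_mem K _
  · have hx : G x ∈ K := Submodule.le_topologicalClosure _ ⟨x, rfl⟩
    rw [Submodule.inner_starProjection_left_eq_right, Submodule.starProjection_eq_self_iff.2 hx,
      InnerProductSpace.toDual_symm_apply]
    have := hg ⟨G x, x, rfl⟩
    refine Eq.trans ?_ this.symm
    exact hwd _ _ (hch ⟨G x, x, rfl⟩).symm

namespace VonNeumannAlgebra

variable {H : Type*} [NormedAddCommGroup H] [InnerProductSpace ℂ H] [CompleteSpace H]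
  {N : VonNeumannAlgebra H}

theorem add_le_add_iff (a b c : N) : a + b ≤ a + c ↔ b ≤ c := by
  rw [le_iff_sub_nonneg, add_sub_add_left_eq_sub, ← le_iff_sub_nonneg]

theorem add_nonneg {a b : N} (ha : 0 ≤ a) (hb : 0 ≤ b) : 0 ≤ a + b :=
  _root_.add_nonneg (a := (a : H →L[ℂ] H)) (b := b) ha hb

theorem smul_nonneg {a : N} (ha : 0 ≤ a) {t : ℝ} (ht : 0 ≤ t) : 0 ≤ (t : ℂ) • a := by
  rw [nonneg_iff_inner] at ha ⊢
  intro ξ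
  change 0 ≤ inner ℂ ((t : ℂ) • (a : H →L[ℂ] H) ξ) ξ
  rw [inner_smul_left, Complex.conj_ofReal]
  exact mul_nonneg (by exact_mod_cast ht) (ha ξ)

/-- Zorn's lemma in the order interval from `0` to `r`: chains there are norm bounded, so they have
suprema, and `hP` carries `P` over to them. -/
theorem exists_maximal {r : N} (hr : 0 ≤ r) {P : N → Prop} (h0 : P 0)
    (hP : ∀ D : Set N, D.Nonempty → DirectedOn (· ≤ ·) D → (∀ x ∈ D, 0 ≤ x ∧ x ≤ r ∧ P x) →
      ∀ s, IsLUB D s → (∀ ξ : H, IsLUB ((fun x => (N.vectorFunctional ξ x).re) '' D)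
        (N.vectorFunctional ξ s).re) → P s) :
    ∃ a, Maximal (fun a => 0 ≤ a ∧ a ≤ r ∧ P a) a := by
  obtain ⟨a, -, ha⟩ := zorn_le_nonempty₀ {a : N | 0 ≤ a ∧ a ≤ r ∧ P a} (fun D hDS hD y hy => by
    have hdir : DirectedOn (· ≤ ·) D := hD.directedOn
    obtain ⟨s, hs, hsξ⟩ := exists_isLUB_of_norm_le ⟨y, hy⟩ hdir (C := ‖r‖)
      fun x hx => norm_le_norm_of_nonneg_of_le (hDS hx).1 (hDS hx).2.1
    refine ⟨s, ⟨(hDS hy).1.trans (hs.1 hy), hs.2 fun x hx => (hDS hx).2.1, ?_⟩, fun z hz => hs.1 hz⟩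
    exact hP D ⟨y, hy⟩ hdir (fun x hx => hDS hx) s hs hsξ) 0 ⟨le_rfl, hr, h0⟩
  exact ⟨a, ha⟩

theorem IsNormal.isLUB_of_nonneg {ω : StrongDual ℂ N} (hω : N.IsNormal ω) {D : Set N}
    (hne : D.Nonempty) (hD : DirectedOn (· ≤ ·) D) (h0 : ∀ x ∈ D, 0 ≤ x) {s : N} (hs : IsLUB D s) :
    IsLUB ((fun x => (ω x).re) '' D) (ω s).re :=
  hω D hne hD (fun x hx => Subtype.ext (IsSelfAdjoint.of_nonneg (x := (x : H →L[ℂ] H)) (h0 x hx)))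
    s hs

/-- A normal state is faithful on a corner of positive weight. -/
theorem exists_faithful_below {ω : StrongDual ℂ N} (hω : ω ∈ N.normalStates) :
    ∃ r : N, 0 ≤ r ∧ 0 < (ω r).re ∧ ∀ x, 0 ≤ x → x ≤ r → (ω x).re ≤ 0 → x = 0 := by
  have hone : (0 : N) ≤ 1 := zero_le_one (α := H →L[ℂ] H)
  obtain ⟨k, hk, hmax⟩ := exists_maximal hone (P := fun x => (ω x).re ≤ 0) (by simp)
    (fun D hne hD h s hs _ => (hω.2.isLUB_of_nonneg hne hD (fun x hx => (h x hx).1) hs).2 (by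
      rintro _ ⟨x, hx, rfl⟩
      exact (h x hx).2.2))
  refine ⟨1 - k, (le_iff_sub_nonneg _ _).1 hk.2.1, ?_, fun x hx hxr hωx => ?_⟩
  · rw [map_sub, map_one_of_mem_stateSpace hω.1, Complex.sub_re, Complex.one_re]
    linarith [hk.2.2]
  · have hle : k + x ≤ k := by
      refine hmax ⟨add_nonneg hk.1 hx, ?_, ?_⟩ ?_
      · rw [← add_sub_cancel k 1]
        exact (add_le_add_iff _ _ _).2 hxr
      · rw [map_add, Complex.add_re]
        linarith [hk.2.2]
      · rw [le_iff_sub_nonneg, add_sub_cancel_left]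
        exact hx
    rw [le_iff_sub_nonneg, sub_add_cancel_left] at hle
    refine le_antisymm ?_ hx
    rw [le_iff_sub_nonneg, zero_sub]
    exact hle

/-- A normal state is dominated by a vector functional below some positive element of positive
weight. -/
theorem exists_le_vectorFunctional {ω : StrongDual ℂ N} (hω : ω ∈ N.normalStates) :
    ∃ (b : N) (ξ : H), 0 ≤ b ∧ 0 < (ω b).re ∧
      ∀ c, 0 ≤ c → c ≤ b → (ω c).re ≤ (N.vectorFunctional ξ c).re := by
  obtain ⟨r, hr, hωr, hfaith⟩ := exists_faithful_below hω
  obtain ⟨ζ, hζ⟩ : ∃ ζ : H, 0 < (N.vectorFunctional ζ r).re := by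
    by_contra! hcon
    obtain ⟨e, he, rfl⟩ := exists_isSelfAdjoint_mul_self_eq hr
    have : e = 0 := by
      refine Subtype.ext (ContinuousLinearMap.ext fun ζ => ?_)
      have h1 := hcon ζ
      have h2 := vectorFunctional_star_mul_self ζ e
      rw [he.star_eq] at h2
      rw [h2, Complex.ofReal_re] at h1
      exact norm_eq_zero.1 (pow_eq_zero_iff two_ne_zero |>.1 (le_antisymm h1 (sq_nonneg _)))
    simp [this] at hωr
  obtain ⟨ξ, hξ⟩ : ∃ ξ : H, (ω r).re < (N.vectorFunctional ξ r).re := by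
    obtain ⟨n, hn⟩ := exists_nat_gt ((ω r).re / (N.vectorFunctional ζ r).re)
    rw [div_lt_iff₀ hζ] at hn
    refine ⟨((n : ℂ) + 1) • ζ, hn.trans_le ?_⟩
    have : N.vectorFunctional (((n : ℂ) + 1) • ζ) r =
        (((n + 1) ^ 2 : ℝ) : ℂ) * N.vectorFunctional ζ r := by
      simp only [vectorFunctional_apply, map_smul, inner_smul_left, inner_smul_right]
      simp
      ring
    rw [this, Complex.re_ofReal_mul]
    gcongr
    nlinarith [(Nat.cast_nonneg n : (0 : ℝ) ≤ n)]
  -- Exhaustion: `a` absorbs as much as possible of where `ω` dominates. A `c ≤ r - a` violating the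
  -- claim could be added to `a`. Faithfulness and the choice of `ξ` exclude `a = r`.
  obtain ⟨a, ha, hmax⟩ := exists_maximal hr
    (P := fun x => (N.vectorFunctional ξ x).re ≤ (ω x).re) (by simp)
    (fun D hne hD h s hs hsξ => (hsξ ξ).2 (by
      rintro _ ⟨x, hx, rfl⟩
      exact (h x hx).2.2.trans (map_re_mono hω.1.1 (hs.1 hx))))
  have hb : 0 ≤ r - a := (le_iff_sub_nonneg _ _).1 ha.2.1
  refine ⟨r - a, ξ, hb, ?_, fun c hc hcb => ?_⟩
  · by_contra! hle
    have hbr : r - a ≤ r := by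
      rw [le_iff_sub_nonneg, sub_sub_cancel]
      exact ha.1
    have := sub_eq_zero.1 (hfaith _ hb hbr hle)
    rw [← this] at ha
    exact absurd ha.2.2 (not_le.2 hξ)
  · by_contra! hlt
    have hle : a + c ≤ a := by
      refine hmax ⟨add_nonneg ha.1 hc, ?_, ?_⟩ ?_
      · rw [← add_sub_cancel a r]
        exact (add_le_add_iff _ _ _).2 hcb
      · rw [map_add, map_add, Complex.add_re, Complex.add_re]
        linarith [ha.2.2]
      · rw [le_iff_sub_nonneg, add_sub_cancel_left]
        exact hc
    have hc0 : c = 0 := by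
      rw [le_iff_sub_nonneg, sub_add_cancel_left] at hle
      refine le_antisymm ?_ hc
      rw [le_iff_sub_nonneg, zero_sub]
      exact hle
    simp [hc0] at hlt

/-- A normal state dominates a nonzero vector functional. -/
theorem exists_vectorFunctional_le {ω : StrongDual ℂ N} (hω : ω ∈ N.normalStates) :
    ∃ ζ : H, ζ ≠ 0 ∧ ∀ x : N, ‖(x : H →L[ℂ] H) ζ‖ ^ 2 ≤ (ω (star x * x)).re := by
  obtain ⟨b, ξ, hb, hωb, hdom⟩ := exists_le_vectorFunctional hω
  obtain ⟨e, he, rfl⟩ := exists_isSelfAdjoint_mul_self_eq hb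
  have hω1 := map_one_of_mem_stateSpace hω.1
  -- Scaling by `t` brings `(ye)⋆(ye)` below `b = e²`, where the domination holds; the `+ 1` in `t`
  -- covers `y = 0`.
  have hye : ∀ y : N, (ω (star (y * e) * (y * e))).re ≤ ‖((y * e : N) : H →L[ℂ] H) ξ‖ ^ 2 := by
    intro y
    obtain ⟨z, hz⟩ := exists_star_mul_self_eq_norm_sq_sub y
    have hM : 0 < ‖y‖ ^ 2 + 1 := by positivity
    set t : ℝ := (‖y‖ ^ 2 + 1)⁻¹ with ht
    have ht0 : 0 < t := inv_pos.2 hM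
    have hmul : (t : ℂ) * ((‖y‖ ^ 2 : ℝ) + 1) = 1 := by
      have : t * (‖y‖ ^ 2 + 1) = 1 := inv_mul_cancel₀ hM.ne'
      exact_mod_cast this
    have hdiff : e * e - (t : ℂ) • (star (y * e) * (y * e)) =
        (t : ℂ) • (star (z * e) * (z * e) + e * e) := by
      have e1 : star (z * e) * (z * e) = e * (star z * z) * e := by
        simp only [star_mul, he.star_eq, mul_assoc]
      have e2 : algebraMap ℝ N (‖y‖ ^ 2) = ((‖y‖ ^ 2 : ℝ) : ℂ) • (1 : N) := by
        rw [Algebra.algebraMap_eq_smul_one, Complex.coe_smul]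
      have e3 : e * e = ((t : ℂ) * ((‖y‖ ^ 2 : ℝ) + 1)) • (e * e) := by rw [hmul, one_smul]
      rw [e1, hz, e2, star_mul, he.star_eq]
      nth_rewrite 1 [e3]
      simp only [mul_sub, sub_mul, mul_smul_comm, smul_mul_assoc, mul_one, mul_assoc]
      module
    have h1 := hdom ((t : ℂ) • (star (y * e) * (y * e)))
      (smul_nonneg (star_mul_self_nonneg _) ht0.le) (by
        rw [le_iff_sub_nonneg, hdiff]
        exact smul_nonneg (add_nonneg (star_mul_self_nonneg _) hb) ht0.le)
    rw [map_smul, map_smul, smul_eq_mul, smul_eq_mul, Complex.re_ofReal_mul,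
      Complex.re_ofReal_mul, vectorFunctional_star_mul_self, Complex.ofReal_re] at h1
    exact le_of_mul_le_mul_left h1 ht0
  let G : N →ₗ[ℂ] H :=
    { toFun := fun x => ((x * e : N) : H →L[ℂ] H) ξ
      map_add' := fun x y => by rw [add_mul]; rfl
      map_smul' := fun c x => by rw [smul_mul_assoc]; rfl }
  let F : N →ₗ[ℂ] ℂ :=
    { toFun := fun x => ω (x * e)
      map_add' := fun x y => by rw [add_mul, map_add]
      map_smul' := fun c x => by rw [smul_mul_assoc, map_smul]; rfl }
  have hcs : ∀ x y : N, ‖ω (star x * (y * e))‖ ^ 2 ≤ (ω (star x * x)).re * ‖G y‖ ^ 2 := fun x y =>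
    (norm_map_star_mul_sq_le hω.1.1 x (y * e)).trans
      (mul_le_mul_of_nonneg_left (hye y) (Complex.nonneg_iff.1 (hω.1.1 x)).1)
  -- A Radon–Nikodym vector: `ω(xe) = ⟪ζ, xeξ⟫`. It is nonzero since `ω(e²) > 0`.
  obtain ⟨ζ, hζG, hζ⟩ := exists_inner_eq_of_norm_le G F fun x => by
    have := hcs 1 x
    rw [star_one, one_mul, one_mul, hω1, Complex.one_re, one_mul] at this
    exact le_of_sq_le_sq this (norm_nonneg _)
  refine ⟨ζ, ?_, fun x => ?_⟩
  · rintro rfl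
    have h1 := hζ e
    rw [inner_zero_left] at h1
    change ω (e * e) = 0 at h1
    rw [h1] at hωb
    exact lt_irrefl _ hωb
  · set C := (ω (star x * x)).re with hC
    have hC0 : 0 ≤ C := (Complex.nonneg_iff.1 (hω.1.1 x)).1
    have hxζ : (x : H →L[ℂ] H) ζ ∈ closure (Set.range G) := by
      refine map_mem_closure (x : H →L[ℂ] H).continuous hζG ?_
      rintro _ ⟨y, rfl⟩
      exact ⟨x * y, by change ((x * y * e : N) : H →L[ℂ] H) ξ = _; rw [mul_assoc]; rfl⟩
    have hcl : IsClosed {v : H | ‖inner ℂ ((x : H →L[ℂ] H) ζ) v‖ ^ 2 ≤ C * ‖v‖ ^ 2} :=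
      isClosed_le (by fun_prop) (by fun_prop)
    -- Cauchy–Schwarz for `ω` bounds the inner product of `xζ` with each `yeξ`. As `xζ` lies in the
    -- closure of these vectors, the bound may be used at `xζ` itself.
    have hsub : Set.range G ⊆ {v : H | ‖inner ℂ ((x : H →L[ℂ] H) ζ) v‖ ^ 2 ≤ C * ‖v‖ ^ 2} := by
      rintro _ ⟨y, rfl⟩
      have e1 : inner ℂ ((x : H →L[ℂ] H) ζ) (G y) = ω (star x * (y * e)) := by
        rw [← ContinuousLinearMap.adjoint_inner_right, ← mul_assoc]
        exact (hζ (star x * y)).symm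
      change ‖inner ℂ ((x : H →L[ℂ] H) ζ) (G y)‖ ^ 2 ≤ _
      rw [e1]
      exact hcs x y
    have hfin := closure_minimal hsub hcl hxζ
    change ‖inner ℂ ((x : H →L[ℂ] H) ζ) ((x : H →L[ℂ] H) ζ)‖ ^ 2 ≤ _ at hfin
    rw [inner_self_eq_norm_sq_to_K, norm_pow, RCLike.norm_ofReal, abs_norm] at hfin
    rcases (norm_nonneg ((x : H →L[ℂ] H) ζ)).eq_or_lt with h0 | h0
    · rw [← h0]; simpa using hC0
    · refine le_of_mul_le_mul_right ?_ (pow_pos h0 2)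
      nlinarith

/-- A normal pure state is a vector state. -/
theorem exists_eq_vectorFunctional {ω : StrongDual ℂ N} (hω : ω ∈ N.normalStates)
    (hp : IsPureState ω) : ∃ η : H, ‖η‖ = 1 ∧ N.vectorFunctional η = ω := by
  obtain ⟨ζ, hζ, hle⟩ := exists_vectorFunctional_le hω
  have hn : ‖ζ‖ ≠ 0 := norm_ne_zero_iff.2 hζ
  have h := hp.eq_smul_of_le (f := N.vectorFunctional ζ) (vectorFunctional_pos ζ) fun x => by
    rw [vectorFunctional_star_mul_self, Complex.ofReal_re]
    exact hle x
  have h1 : N.vectorFunctional ζ 1 = (‖ζ‖ : ℂ) ^ 2 := by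
    rw [vectorFunctional_apply]
    exact inner_self_eq_norm_sq_to_K ζ
  refine ⟨((‖ζ‖ : ℂ)⁻¹) • ζ, by simp [norm_smul, hn], ?_⟩
  ext x
  have h2 := h x
  rw [h1, vectorFunctional_apply] at h2
  rw [vectorFunctional_apply, map_smul, inner_smul_left, inner_smul_right, h2]
  have : (‖ζ‖ : ℂ) ≠ 0 := by exact_mod_cast hn
  simp only [map_inv₀, Complex.conj_ofReal]
  field_simp

/-- A normal pure state `ω` has a minimal support projection `p`, that is, `p x p = ω(x) p`. -/
theorem exists_minimal_projection {ω : StrongDual ℂ N} (hω : ω ∈ N.normalStates)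
    (hp : IsPureState ω) : ∃ p : N, p ≠ 0 ∧ ∀ x, p * x * p = ω x • p := by
  obtain ⟨η, hη, hηω⟩ := exists_eq_vectorFunctional hω hp
  let G : N.commutant →ₗ[ℂ] H :=
    { toFun := fun a => (a : H →L[ℂ] H) η
      map_add' := fun a b => rfl
      map_smul' := fun c a => rfl }
  set K := (LinearMap.range G).topologicalClosure with hK
  have hpN : K.starProjection ∈ N := by
    rw [IsStarProjection.mem_iff (isStarProjection_starProjection (U := K))]
    intro y hy
    rw [Submodule.range_starProjection]
    intro v hv
    refine map_mem_closure y.continuous hv ?_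
    rintro _ ⟨a, rfl⟩
    exact ⟨⟨y, hy⟩ * a, rfl⟩
  -- For `a ∈ N'` the functional of `aη` is at most `‖a‖² ω`, so purity makes it a multiple of `ω`.
  -- Polarization and closure then extend the identity to all of `K`.
  have hdiag : ∀ (x : N) (v : H), v ∈ LinearMap.range G →
      inner ℂ v ((x : H →L[ℂ] H) v - ω x • v) = 0 := by
    rintro x _ ⟨a, rfl⟩
    have h := hp.eq_smul_of_le_mul (f := N.vectorFunctional (G a)) (vectorFunctional_pos _)
      (C := ‖(a : H →L[ℂ] H)‖ ^ 2 + 1) (by positivity) (fun y => by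
        rw [← hηω, vectorFunctional_star_mul_self, vectorFunctional_star_mul_self,
          Complex.ofReal_re, Complex.ofReal_re]
        have hcomm : (y : H →L[ℂ] H) (G a) = (a : H →L[ℂ] H) ((y : H →L[ℂ] H) η) :=
          congrArg (fun S : H →L[ℂ] H => S η) (N.commute_of_mem_commutant y.2 a.2).eq.symm
        rw [hcomm]
        have hop := (a : H →L[ℂ] H).le_opNorm ((y : H →L[ℂ] H) η)
        calc _ ≤ (‖(a : H →L[ℂ] H)‖ * ‖(y : H →L[ℂ] H) η‖) ^ 2 := by gcongr
          _ ≤ _ := by nlinarith [sq_nonneg ‖(y : H →L[ℂ] H) η‖]) x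
    rw [vectorFunctional_apply, vectorFunctional_apply] at h
    rw [inner_sub_right, inner_smul_right, h, mul_comm]
    exact sub_self _
  have hoff : ∀ (x : N) (v w : H), v ∈ LinearMap.range G → w ∈ LinearMap.range G →
      inner ℂ v ((x : H →L[ℂ] H) w - ω x • w) = 0 := by
    intro x v w hv hw
    let T : H →L[ℂ] H := (x : H →L[ℂ] H) - ω x • 1
    have hT : ∀ u ∈ LinearMap.range G, inner ℂ u (T u) = 0 := fun u hu => hdiag x u hu
    change inner ℂ v (T w) = 0
    have h1 := hT (v + w) (Submodule.add_mem _ hv hw)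
    have h2 := hT (v + Complex.I • w) (Submodule.add_mem _ hv (Submodule.smul_mem _ _ hw))
    simp only [map_add, map_smul, inner_add_left, inner_add_right, inner_smul_left,
      inner_smul_right, hT v hv, hT w hw, Complex.conj_I] at h1 h2
    linear_combination (1 / 2 : ℂ) * h1 - (Complex.I / 2) * h2 +
      ((inner ℂ v (T w)) / 2 - (inner ℂ w (T v)) / 2) * Complex.I_sq
  have hcl : ∀ (x : N) (v w : H), v ∈ K → w ∈ K →
      inner ℂ v ((x : H →L[ℂ] H) w - ω x • w) = 0 := by
    intro x v w hv hw
    have h1 : ∀ v ∈ LinearMap.range G, inner ℂ v ((x : H →L[ℂ] H) w - ω x • w) = 0 := fun v hv =>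
      closure_minimal (s := (LinearMap.range G : Set H))
        (t := {w | inner ℂ v ((x : H →L[ℂ] H) w - ω x • w) = 0})
        (fun w hw => hoff x v w hv hw) (isClosed_eq (by fun_prop) continuous_const) hw
    exact closure_minimal (s := (LinearMap.range G : Set H))
      (t := {v | inner ℂ v ((x : H →L[ℂ] H) w - ω x • w) = 0})
      (fun v hv => h1 v hv) (isClosed_eq (by fun_prop) continuous_const) hv
  refine ⟨⟨K.starProjection, hpN⟩, fun h0 => ?_, fun x => ?_⟩
  · have hηK : η ∈ K := Submodule.le_topologicalClosure _ ⟨1, rfl⟩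
    have h1 : K.starProjection η = η := Submodule.starProjection_eq_self_iff.2 hηK
    rw [show K.starProjection = 0 from congrArg Subtype.val h0] at h1
    rw [← h1] at hη
    simp at hη
  · refine Subtype.ext (ContinuousLinearMap.ext fun w => ext_inner_left ℂ fun v => ?_)
    change inner ℂ v (K.starProjection ((x : H →L[ℂ] H) (K.starProjection w))) =
      inner ℂ v (ω x • K.starProjection w)
    have h1 := hcl x (K.starProjection v) (K.starProjection w)
      (Submodule.starProjection_apply_mem K v) (Submodule.starProjection_apply_mem K w)
    rw [inner_sub_right, sub_eq_zero] at h1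
    rw [← Submodule.inner_starProjection_left_eq_right, h1,
      Submodule.inner_starProjection_left_eq_right, map_smul,
      Submodule.starProjection_eq_self_iff.2 (Submodule.starProjection_apply_mem K w)]

end VonNeumannAlgebra

theorem corollary1p8 {H : Type*} [NormedAddCommGroup H] [InnerProductSpace ℂ H] [CompleteSpace H]
    (N : VonNeumannAlgebra H) (hfactor : N.IsFactor) (hsimple : IsSimpleCStarAlgebra N)
    (hproper : N.normalStates ⊂ stateSpace N) :
    (∀ ω ∈ N.normalStates, ¬ IsPureState ω) ∧
      ¬ ∃ (E : Type*) (_ : CStarAlgebra E) (L : NonUnitalStarSubalgebra ℂ E) (ξ : N →⋆ₐ[ℂ] E),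
        IsIdealHost N.normalStates L ξ := by
  have hpure : ∀ ω ∈ N.normalStates, ¬ IsPureState ω := fun ω hω hp => by
    obtain ⟨p, hp0, hpω⟩ := VonNeumannAlgebra.exists_minimal_projection hω hp
    have := hsimple.finiteDimensional hp0 ω hpω
    exact hproper.ne VonNeumannAlgebra.normalStates_eq_of_finiteDimensional
  refine ⟨hpure, ?_⟩
  rintro ⟨E, _, L, ξ, h⟩
  have := hsimple.1
  obtain ⟨ψ, hψ, hψp⟩ := h.exists_isPureState VonNeumannAlgebra.normalStates_nonempty
    VonNeumannAlgebra.isExtreme_normalStates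
  exact hpure ψ hψ hψp
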